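/- **Setting.** Let $\Sigma=(A,G,\alpha,\sigma)$ be a twisted unital discrete $C^*$-dynamical system: $A$ is a unital $C^*$-algebra, $G$ is a discrete group with identity $e$, and $\alpha:G\to\mathrm{Aut}(A)$, $\sigma:G\times G\to\mathcal U(A)$ are maps such that, for all $g,h,k\in G$, $$\alpha_g\circ\alpha_h=\mathrm{Ad}(\sigma(g,h))\circ\alpha_{gh},\qquad \sigma(g,h)\,\sigma(gh,k)=\alpha_g(\sigma(h,k))\,\sigma(g,hk),\qquad \sigma(g,e)=\sigma(e,g)=1 .$$ Let $A$ act faithfully on a Hilbert space $\mathcal H$. The reduced crossed product $C_r^*(\Sigma)$ is the $C^*$-algebra of operators on $\ell^2(G,\mathcal H)$ generated by the operators $(\pi(a)\xi)(h)=\alpha_{h^{-1}}(a)\,\xi(h)$ for $a\in A$ and the unitaries $(\lambda(g)\xi)(h)=\sigma(h^{-1},g)\,\xi(g^{-1}h)$ for $g\in G$; up to canonical isomorphism it does not depend on $\mathcal H$. Identify $A$ with $\pi(A)$, and let $E:C_r^*(\Sigma)\to A$ be the canonical conditional expectation, so that $E(a)=a$ for $a\in A$ and $E(a\lambda(g))=0$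 for $a\in A$, $g\neq e$. "Ideal" means closed two-sided ideal. An ideal $J$ of $A$ is invariant if $\alpha_g(J)=J$ for all $g\in G$. In that case $\Sigma/J=(A/J,G,\dot\alpha,\dot\sigma)$ denotes the induced system, and $\langle J\rangle$ denotes the ideal of $C_r^*(\Sigma)$ generated by $J$. A maximal invariant ideal of $A$ is a maximal element among the proper invariant ideals of $A$. A maximal ideal of $C_r^*(\Sigma)$ is a maximal element among its proper ideals. A $C^*$-algebra is simple if it is nonzero and has no ideals other than $\{0\}$ and itself. The system $\Sigma$ is exact if, for every invariant ideal $J$ of $A$, the ideal $\langle J\rangle$ is the kernel of the canonical $^*$-homomorphism $C_r^*(\Sigma)\to C_r^*(\Sigma/J)$ given by $a\mapsto a+J$, $\lambda(g)\mapsto\lambda(g)$. It has property (DP) if $$0\in\overline{\mathrm{co}\{v\,y\,v^*\mid v\in\mathcal U(C_r^*(\Sigma))\}}^{\,\|\cdot\|}\quad\text{for every } y=y^*\in C_r^*(\Sigma)\text{ with }E(y)=0 .$$ **Theorem.** Assume that $\Sigma$ is exact and has property (DP). Then $J\mapsto\langle J\rangle$ is a bijection from the set of maximal invariant ideals of $A$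 onto the set of maximal ideals of $C_r^*(\Sigma)$. Moreover, the simple quotients of $C_r^*(\Sigma)$ are exactly the $C^*$-algebras $C_r^*(\Sigma/J)$ for $J$ a maximal invariant ideal of $A$. That is: 1. For every maximal invariant ideal $J$ of $A$, the algebra $C_r^*(\Sigma/J)$ is simple, and the canonical map $C_r^*(\Sigma)\to C_r^*(\Sigma/J)$ induces a $^*$-isomorphism $C_r^*(\Sigma)/\langle J\rangle\cong C_r^*(\Sigma/J)$. 2. If $\mathcal I$ is an ideal of $C_r^*(\Sigma)$ such that $C_r^*(\Sigma)/\mathcal I$ is simple, then there is a maximal invariant ideal $J$ of $A$ with $\mathcal I=\langle J\rangle$, and the canonical map induces a $^*$-isomorphism $C_r^*(\Sigma)/\mathcal I\cong C_r^*(\Sigma/J)$. -/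

import Mathlib

/-- Closed two-sided ideals of a unital C⋆-algebra (simply called ideals below). -/
structure ClosedIdeal (A : Type*) [CStarAlgebra A] where
  toIdeal : Ideal A
  isTwoSided : toIdeal.IsTwoSided
  isClosed : IsClosed (toIdeal : Set A)

namespace ClosedIdeal

section Basic
variable {A : Type*} [CStarAlgebra A]

instance : SetLike (ClosedIdeal A) A where
  coe J := (J.toIdeal : Set A)
  coe_injective := by
    rintro ⟨I, _, _⟩ ⟨J, _, _⟩ h
    have : I = J := SetLike.coe_injective h
    subst this
    rfl

instance : PartialOrder (ClosedIdeal A) := PartialOrder.lift (fun J => (J : Set A)) SetLike.coe_injective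

theorem mem_toIdeal {J : ClosedIdeal A} {a : A} : a ∈ J.toIdeal ↔ a ∈ J := Iff.rfl

theorem mul_mem_left (J : ClosedIdeal A) (a : A) {b : A} (hb : b ∈ J) : a * b ∈ J :=
  J.toIdeal.mul_mem_left a hb

theorem mul_mem_right (J : ClosedIdeal A) {a : A} (b : A) (ha : a ∈ J) : a * b ∈ J :=
  haveI := J.isTwoSided
  J.toIdeal.mul_mem_right b ha

/-- The closed two-sided ideal generated by a set. -/
def generated (S : Set A) : ClosedIdeal A where
  toIdeal := sInf {I : Ideal A | I.IsTwoSided ∧ IsClosed (I : Set A) ∧ S ⊆ I}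
  isTwoSided := ⟨fun {a} b ha => by
    rw [Submodule.mem_sInf] at ha ⊢
    intro I hI
    have := hI.1
    exact Ideal.mul_mem_right (I := I) b (ha I hI)⟩
  isClosed := by
    rw [Submodule.coe_sInf]
    exact isClosed_biInter fun I hI => hI.2.1

/-- Maximal elements among the proper closed two-sided ideals. -/
def IsMaximal (J : ClosedIdeal A) : Prop :=
  Maximal (fun K : ClosedIdeal A => (K : Set A) ≠ Set.univ) J

/-- The quotient C⋆-algebra `A/J`, with the quotient norm. -/
def Quot (J : ClosedIdeal A) : Type _ := A ⧸ J.toIdeal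
end Basic

section Quot
variable {A : Type*} [CStarAlgebra A]

open CStarAlgebra in
/-- For `j` in a closed two-sided ideal there are contractions `e` in the ideal with `j (1 - e)`
arbitrarily small. -/
theorem exists_approx (J : ClosedIdeal A) {j : A} (hj : j ∈ J) {ε : ℝ} (hε : 0 < ε) :
    ∃ e ∈ J, IsSelfAdjoint e ∧ ‖1 - e‖ ≤ 1 ∧ ‖j * (1 - e)‖ < ε := by
  let _ := CStarAlgebra.spectralOrder A
  have := CStarAlgebra.spectralOrderedRing A
  set h : A := star j * j with hh
  have hpos : 0 ≤ h := star_mul_self_nonneg j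
  have hsa : IsSelfAdjoint h := .of_nonneg hpos
  have hδ : 0 < ε ^ 2 / 2 := by positivity
  set δ := ε ^ 2 / 2 with hδdef
  have hspec : ∀ x ∈ spectrum ℝ h, 0 ≤ x := fun x hx => spectrum_nonneg_of_nonneg hpos hx
  have hc1 : ContinuousOn (fun x : ℝ => (x + δ)⁻¹) (spectrum ℝ h) := by
    apply ContinuousOn.inv₀ (by fun_prop)
    intro x hx; have := hspec x hx; positivity
  have hc2 : ContinuousOn (fun x : ℝ => δ * (x + δ)⁻¹) (spectrum ℝ h) := by fun_prop
  have hid : ContinuousOn (fun x : ℝ => x) (spectrum ℝ h) := by fun_prop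
  set e : A := cfc (fun x : ℝ => (x + δ)⁻¹) h * h with he
  have hkey : 1 - e = cfc (fun x : ℝ => δ * (x + δ)⁻¹) h := by
    have h1 : e = cfc (fun x : ℝ => (x + δ)⁻¹ * x) h := by
      rw [he, cfc_mul _ _ h hc1 hid, cfc_id' ℝ h]
    have h2 : (1 : A) = cfc (fun _ : ℝ => (1 : ℝ)) h := (cfc_const_one ℝ h).symm
    rw [h1, h2, ← cfc_sub (fun _ : ℝ => (1 : ℝ)) (fun x : ℝ => (x + δ)⁻¹ * x) h
      (by fun_prop) (hc1.mul hid)]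
    apply cfc_congr
    intro x hx
    have := hspec x hx
    have : x + δ ≠ 0 := by positivity
    field_simp
    ring
  have hsa1 : IsSelfAdjoint (1 - e) := by rw [hkey]; exact cfc_predicate _ h
  refine ⟨e, J.mul_mem_left _ (J.mul_mem_left _ hj), ?_, ?_, ?_⟩
  · have := (IsSelfAdjoint.one A).sub hsa1
    simpa using this
  · rw [hkey]
    apply norm_cfc_le zero_le_one
    intro x hx
    have := hspec x hx
    rw [Real.norm_of_nonneg (by positivity), mul_inv_le_iff₀ (by positivity)]
    linarith
  · have h2 : star (j * (1 - e)) * (j * (1 - e)) =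
        cfc (fun x : ℝ => δ * (x + δ)⁻¹ * x * (δ * (x + δ)⁻¹)) h := by
      rw [star_mul, hsa1.star_eq,
        cfc_mul (fun x : ℝ => δ * (x + δ)⁻¹ * x) (fun x : ℝ => δ * (x + δ)⁻¹) h (hc2.mul hid) hc2,
        cfc_mul (fun x : ℝ => δ * (x + δ)⁻¹) (fun x : ℝ => x) h hc2 hid,
        cfc_id' ℝ h, ← hkey, hh]
      simp only [mul_assoc]
    have h3 : ‖j * (1 - e)‖ ^ 2 ≤ δ := by
      rw [sq, ← CStarRing.norm_star_mul_self, h2]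
      apply norm_cfc_le hδ.le
      intro x hx
      have hx0 := hspec x hx
      rw [Real.norm_of_nonneg (by positivity)]
      have hxd : 0 < x + δ := by positivity
      have e1 : (x + δ)⁻¹ * (x + δ) = 1 := inv_mul_cancel₀ hxd.ne'
      have i0 : 0 < (x + δ)⁻¹ := by positivity
      have e2 : (x + δ)⁻¹ * x ≤ 1 := by nlinarith
      have e3 : δ * (x + δ)⁻¹ ≤ 1 := by nlinarith
      calc δ * (x + δ)⁻¹ * x * (δ * (x + δ)⁻¹) = δ * ((x + δ)⁻¹ * x) * (δ * (x + δ)⁻¹) := by ring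
        _ ≤ δ * 1 * 1 := by gcongr
        _ = δ := by ring
    have h4 : ‖j * (1 - e)‖ ^ 2 < ε ^ 2 := by
      have : 0 < ε ^ 2 := by positivity
      linarith
    exact lt_of_pow_lt_pow_left₀ 2 hε.le h4

theorem star_mem (J : ClosedIdeal A) {a : A} (ha : a ∈ J) : star a ∈ J := by
  have hcl : star a ∈ closure (J.toIdeal : Set A) := by
    rw [Metric.mem_closure_iff]
    intro ε hε
    obtain ⟨e, he, hsa, -, h⟩ := J.exists_approx ha hε
    refine ⟨e * star a, J.mul_mem_right _ he, ?_⟩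
    rw [dist_eq_norm, ← norm_star]
    simpa [mul_sub, hsa.star_eq] using h
  rwa [J.isClosed.closure_eq] at hcl

variable (J : ClosedIdeal A)

noncomputable instance : NormedRing J.Quot :=
  haveI := J.isTwoSided
  haveI : IsClosed (J.toIdeal : Set A) := J.isClosed
  { (Ideal.Quotient.ring J.toIdeal : Ring (A ⧸ J.toIdeal)),
    (Submodule.Quotient.normedAddCommGroup J.toIdeal : NormedAddCommGroup (A ⧸ J.toIdeal)) with
    norm_mul_le := by
      intro (x : A ⧸ J.toIdeal) (y : A ⧸ J.toIdeal)
      change ‖x * y‖ ≤ ‖x‖ * ‖y‖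
      have key : ∀ ε : ℝ, 0 < ε → ‖x * y‖ ≤ (‖x‖ + ε) * (‖y‖ + ε) := by
        intro ε hε
        obtain ⟨a, rfl, ha⟩ := Submodule.Quotient.norm_mk_lt (S := J.toIdeal) x hε
        obtain ⟨b, rfl, hb⟩ := Submodule.Quotient.norm_mk_lt (S := J.toIdeal) y hε
        calc _ ≤ ‖a * b‖ := Submodule.Quotient.norm_mk_le J.toIdeal (a * b)
          _ ≤ ‖a‖ * ‖b‖ := norm_mul_le a b
          _ ≤ _ := by gcongr
      have ht : Filter.Tendsto (fun ε : ℝ => (‖x‖ + ε) * (‖y‖ + ε)) (nhdsWithin 0 (Set.Ioi 0))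
          (nhds ((‖x‖ + 0) * (‖y‖ + 0))) :=
        (Continuous.tendsto (by fun_prop) 0).mono_left nhdsWithin_le_nhds
      have := ge_of_tendsto ht (Filter.eventually_of_mem self_mem_nhdsWithin fun ε hε => key ε hε)
      simpa using this }

noncomputable instance : NormedAlgebra ℂ J.Quot :=
  haveI := J.isTwoSided
  { (Submodule.Quotient.normedSpace J.toIdeal ℂ : NormedSpace ℂ (A ⧸ J.toIdeal)),
    (Ideal.Quotient.algebra ℂ : Algebra ℂ (A ⧸ J.toIdeal)) with }

instance : CompleteSpace J.Quot :=
  inferInstanceAs (CompleteSpace (A ⧸ J.toIdeal))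

/-- The quotient map, as a map of algebras. -/
def mkAlg : A →ₐ[ℂ] J.Quot :=
  haveI := J.isTwoSided
  Ideal.Quotient.mkₐ ℂ J.toIdeal

theorem mkAlg_surjective : Function.Surjective J.mkAlg := Submodule.Quotient.mk_surjective _

theorem mkAlg_eq_zero_iff {a : A} : J.mkAlg a = 0 ↔ a ∈ J :=
  Submodule.Quotient.mk_eq_zero J.toIdeal

theorem mkAlg_eq_iff {a b : A} : J.mkAlg a = J.mkAlg b ↔ a - b ∈ J := by
  rw [← sub_eq_zero, ← map_sub, mkAlg_eq_zero_iff]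

theorem norm_mkAlg_le (a : A) : ‖J.mkAlg a‖ ≤ ‖a‖ := Submodule.Quotient.norm_mk_le J.toIdeal a

theorem exists_norm_lt (x : J.Quot) {ε : ℝ} (hε : 0 < ε) : ∃ a, J.mkAlg a = x ∧ ‖a‖ < ‖x‖ + ε :=
  Submodule.Quotient.norm_mk_lt (S := J.toIdeal) x hε

noncomputable instance : Star J.Quot where
  star x := Quotient.liftOn' x (fun a => J.mkAlg (star a)) (by
    intro a b h
    rw [mkAlg_eq_iff, ← star_sub]
    exact J.star_mem ((Submodule.quotientRel_def J.toIdeal).1 h))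

theorem star_mkAlg (a : A) : star (J.mkAlg a) = J.mkAlg (star a) := rfl

noncomputable instance : StarRing J.Quot where
  star_involutive x := by
    obtain ⟨a, rfl⟩ := J.mkAlg_surjective x
    simp [star_mkAlg]
  star_mul x y := by
    obtain ⟨a, rfl⟩ := J.mkAlg_surjective x
    obtain ⟨b, rfl⟩ := J.mkAlg_surjective y
    simp [star_mkAlg, ← map_mul]
  star_add x y := by
    obtain ⟨a, rfl⟩ := J.mkAlg_surjective x
    obtain ⟨b, rfl⟩ := J.mkAlg_surjective y
    simp [star_mkAlg, ← map_add]

instance : StarModule ℂ J.Quot where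
  star_smul c x := by
    obtain ⟨a, rfl⟩ := J.mkAlg_surjective x
    simp [star_mkAlg, ← map_smul]

instance : CStarRing J.Quot where
  norm_mul_self_le x := by
    refine le_of_forall_pos_le_add fun ε hε => ?_
    obtain ⟨a, rfl⟩ := J.mkAlg_surjective x
    obtain ⟨b, hb, hbn⟩ := J.exists_norm_lt (star (J.mkAlg a) * J.mkAlg a) (half_pos hε)
    rw [star_mkAlg, ← map_mul, mkAlg_eq_iff] at hb
    obtain ⟨e, he, hsa, h1, h2⟩ := J.exists_approx hb (half_pos hε)
    have hsa1 : star (1 - e) = 1 - e := by simp [hsa.star_eq]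
    have hq : J.mkAlg a = J.mkAlg (a * (1 - e)) := by
      rw [mkAlg_eq_iff]
      simpa [mul_sub] using J.mul_mem_left a he
    have h3 : star (a * (1 - e)) * (a * (1 - e))
        = (1 - e) * b * (1 - e) - (1 - e) * ((b - star a * a) * (1 - e)) := by
      rw [star_mul, hsa1]; noncomm_ring
    calc ‖J.mkAlg a‖ * ‖J.mkAlg a‖ ≤ ‖a * (1 - e)‖ * ‖a * (1 - e)‖ := by
          rw [hq]; gcongr <;> exact J.norm_mkAlg_le _
      _ = ‖(1 - e) * b * (1 - e) - (1 - e) * ((b - star a * a) * (1 - e))‖ := by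
          rw [← CStarRing.norm_star_mul_self, h3]
      _ ≤ ‖(1 - e) * b * (1 - e)‖ + ‖(1 - e) * ((b - star a * a) * (1 - e))‖ := norm_sub_le _ _
      _ ≤ 1 * ‖b‖ * 1 + 1 * ‖(b - star a * a) * (1 - e)‖ := by
          gcongr
          · refine (norm_mul_le _ _).trans ?_
            gcongr
            refine (norm_mul_le _ _).trans ?_
            gcongr
          · refine (norm_mul_le _ _).trans ?_
            gcongr
      _ ≤ _ := by linarith

noncomputable instance : CStarAlgebra J.Quot where
  star_add := star_add
  norm_mul_self_le := CStarRing.norm_mul_self_le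

/-- The quotient map of a C⋆-algebra by a closed two-sided ideal. -/
def quotMap : A →⋆ₐ[ℂ] J.Quot where
  __ := J.mkAlg
  map_star' a := (J.star_mkAlg a).symm

end Quot
end ClosedIdeal

section L2
open scoped ComplexOrder InnerProductSpace
variable {I J : Type*} {E : I → Type*} {F : J → Type*}
  [∀ i, NormedAddCommGroup (E i)] [∀ i, InnerProductSpace ℂ (E i)]
  [∀ j, NormedAddCommGroup (F j)] [∀ j, InnerProductSpace ℂ (F j)]

theorem l2Map_sum_le (s : J → I) (hs : Function.Injective s) (T : ∀ j, E (s j) →L[ℂ] F j)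
    (C : ℝ) (hT : ∀ j, ‖T j‖ ≤ C) (ξ : lp E 2) (t : Finset J) :
    ∑ j ∈ t, ‖T j (ξ (s j))‖ ^ (2 : ENNReal).toReal ≤ (|C| * ‖ξ‖) ^ (2 : ENNReal).toReal := by
  classical
  have h2 : (0 : ℝ) < (2 : ENNReal).toReal := by norm_num
  calc ∑ j ∈ t, ‖T j (ξ (s j))‖ ^ (2 : ENNReal).toReal
      ≤ ∑ j ∈ t, |C| ^ (2 : ENNReal).toReal * ‖ξ (s j)‖ ^ (2 : ENNReal).toReal := by
        gcongr with j _
        rw [← Real.mul_rpow (abs_nonneg _) (norm_nonneg _)]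
        gcongr
        refine ((T j).le_opNorm _).trans ?_
        gcongr
        exact (hT j).trans (le_abs_self C)
    _ = |C| ^ (2 : ENNReal).toReal * ∑ i ∈ t.image s, ‖ξ i‖ ^ (2 : ENNReal).toReal := by
        rw [Finset.sum_image (fun _ _ _ _ h => hs h), Finset.mul_sum]
    _ ≤ |C| ^ (2 : ENNReal).toReal * ‖ξ‖ ^ (2 : ENNReal).toReal := by
        gcongr
        exact lp.sum_rpow_le_norm_rpow h2 ξ _
    _ = _ := (Real.mul_rpow (abs_nonneg _) (norm_nonneg _)).symm

/-- The bounded operator `(l2Map ξ) j = T j (ξ (s j))` between Hilbert sums, for an injective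
reindexing `s` and a uniformly bounded family `T`. -/
noncomputable def l2Map (s : J → I) (hs : Function.Injective s) (T : ∀ j, E (s j) →L[ℂ] F j)
    (C : ℝ) (hT : ∀ j, ‖T j‖ ≤ C) : lp E 2 →L[ℂ] lp F 2 :=
  LinearMap.mkContinuous
    { toFun := fun ξ => ⟨fun j => T j (ξ (s j)), memℓp_gen' (l2Map_sum_le s hs T C hT ξ)⟩
      map_add' := fun ξ η => by ext j; exact map_add (T j) _ _
      map_smul' := fun c ξ => by ext j; exact map_smul (T j) c _ }
    |C| (fun ξ => lp.norm_le_of_forall_sum_le (by norm_num) (by positivity)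
      (l2Map_sum_le s hs T C hT ξ))

theorem l2Map_apply (s : J → I) (hs : Function.Injective s) (T : ∀ j, E (s j) →L[ℂ] F j)
    (C : ℝ) (hT : ∀ j, ‖T j‖ ≤ C) (ξ : lp E 2) (j : J) :
    l2Map s hs T C hT ξ j = T j (ξ (s j)) := rfl

variable [∀ i, CompleteSpace (E i)] [∀ j, CompleteSpace (F j)]

theorem adjoint_l2Map_single [DecidableEq I] [DecidableEq J] (s : J → I) (hs : Function.Injective s)
    (T : ∀ j, E (s j) →L[ℂ] F j) (C : ℝ) (hT : ∀ j, ‖T j‖ ≤ C) (j : J) (y : F j) :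
    (l2Map s hs T C hT).adjoint (lp.single 2 j y) = lp.single 2 (s j) ((T j).adjoint y) := by
  refine ext_inner_left ℂ fun ξ => ?_
  rw [ContinuousLinearMap.adjoint_inner_right, lp.inner_single_right, lp.inner_single_right,
    ContinuousLinearMap.adjoint_inner_right, l2Map_apply]

theorem l2Map_comp_adjoint (s : J → I) (hs : Function.Injective s)
    (T : ∀ j, E (s j) →L[ℂ] F j) (C : ℝ) (hT : ∀ j, ‖T j‖ ≤ C)
    (h : ∀ j, T j ∘L (T j).adjoint = 1) :
    l2Map s hs T C hT ∘L (l2Map s hs T C hT).adjoint = 1 := by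
  classical
  have key : ∀ (j : J) (y : F j),
      l2Map s hs T C hT ((l2Map s hs T C hT).adjoint (lp.single 2 j y)) = lp.single 2 j y := by
    intro j y
    rw [adjoint_l2Map_single]
    ext k
    rw [l2Map_apply]
    by_cases hk : k = j
    · subst hk
      rw [lp.single_apply_self, lp.single_apply_self]
      exact congrArg (fun S => S y) (h k)
    · rw [lp.single_apply_ne _ _ _ (fun h' => hk (hs h')), lp.single_apply_ne _ _ _ hk, map_zero]
  ext ξ j
  refine ext_inner_left ℂ fun y => ?_
  rw [← lp.inner_single_left, ← lp.inner_single_left]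
  simp only [ContinuousLinearMap.comp_apply, one_apply_eq_self]
  rw [← ContinuousLinearMap.adjoint_inner_left, ← ContinuousLinearMap.adjoint_inner_right,
    ContinuousLinearMap.adjoint_inner_right, ContinuousLinearMap.adjoint_inner_left]
  rw [← ContinuousLinearMap.adjoint_inner_left, ← ContinuousLinearMap.adjoint_inner_left,
   ContinuousLinearMap.adjoint_adjoint, key]

theorem adjoint_l2Map_diag {E F : I → Type*}
    [∀ i, NormedAddCommGroup (E i)] [∀ i, InnerProductSpace ℂ (E i)]
    [∀ i, NormedAddCommGroup (F i)] [∀ i, InnerProductSpace ℂ (F i)]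
    [∀ i, CompleteSpace (E i)] [∀ i, CompleteSpace (F i)]
    (T : ∀ i, E i →L[ℂ] F i) (C D : ℝ) (hT : ∀ i, ‖T i‖ ≤ C) (S : ∀ i, F i →L[ℂ] E i)
    (hS : ∀ i, ‖S i‖ ≤ D) (h : ∀ i, S i = (T i).adjoint) :
    (l2Map id Function.injective_id T C hT).adjoint = l2Map id Function.injective_id S D hS := by
  symm
  rw [ContinuousLinearMap.eq_adjoint_iff]
  intro x y
  rw [lp.inner_eq_tsum, lp.inner_eq_tsum]
  congr 1
  ext i
  rw [l2Map_apply, l2Map_apply, h, ContinuousLinearMap.adjoint_inner_left]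
  rfl
end L2

section Univ
open scoped ComplexOrder InnerProductSpace
variable {A : Type*} [CStarAlgebra A] [PartialOrder A] [StarOrderedRing A]

variable (A) in
/-- The Hilbert sum of the GNS representations of all positive linear functionals of `A`. -/
noncomputable def gnsSumRep : A →⋆ₐ[ℂ]
    (lp (fun f : A →ₚ[ℂ] ℂ => f.GNS) 2 →L[ℂ] lp (fun f : A →ₚ[ℂ] ℂ => f.GNS) 2) where
  toFun a := l2Map id Function.injective_id (fun f => f.gnsStarAlgHom a) ‖a‖
    (fun f => NonUnitalStarAlgHom.norm_apply_le f.gnsStarAlgHom a)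
  map_one' := by ext ξ f; rw [l2Map_apply, map_one]; rfl
  map_mul' a b := by ext ξ f; simp only [mul_apply_eq_comp, l2Map_apply, map_mul]; rfl
  map_zero' := by ext ξ f; rw [l2Map_apply, map_zero]; rfl
  map_add' a b := by ext ξ f; simp only [add_apply, l2Map_apply, map_add]; rfl
  commutes' c := by
    ext ξ f
    simp only [l2Map_apply, AlgHomClass.commutes]
    rfl
  map_star' a := by
    rw [ContinuousLinearMap.star_eq_adjoint]
    symm
    apply adjoint_l2Map_diag
    intro f
    rw [map_star, ContinuousLinearMap.star_eq_adjoint]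

theorem exists_posFunctional {a : A} (ha : ¬ 0 ≤ a) (hsa : IsSelfAdjoint a) :
    ∃ f : A →ₚ[ℂ] ℂ, ¬ 0 ≤ f a := by
  let C : ProperCone ℝ A :=
    { carrier := {x | 0 ≤ x}
      add_mem' := fun h k => add_nonneg h k
      zero_mem' := le_refl (0 : A)
      smul_mem' := fun c x hx => smul_nonneg c.2 hx
      isClosed' := CStarAlgebra.isClosed_nonneg }
  obtain ⟨f, hf, hfa⟩ := C.hyperplane_separation_point (x₀ := a) ha
  let g : A →ₗ[ℝ] ℝ := f.toLinearMap ∘ₗ (selfAdjoint.submodule ℝ A).subtype ∘ₗ realPart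
  have hg : ∀ x : A, IsSelfAdjoint x → g x = f x := fun x hx => by
    change f ((realPart x : selfAdjoint A) : A) = f x
    rw [hx.coe_realPart]
  have hgI : ∀ x : A, IsSelfAdjoint x → g (Complex.I • x) = 0 := fun x hx => by
    change f ((realPart (Complex.I • x) : selfAdjoint A) : A) = 0
    rw [realPart_I_smul, hx.imaginaryPart]
    simp
  let F : A →ₗ[ℂ] ℂ := Module.Dual.extendRCLike (𝕜 := ℂ) g
  have hF : ∀ x : A, IsSelfAdjoint x → F x = (f x : ℂ) := fun x hx => by
    simp [F, Module.Dual.extendRCLike_apply, hg x hx, hgI x hx]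
  refine ⟨PositiveLinearMap.mk₀ F fun x hx => ?_, ?_⟩
  · rw [hF x (.of_nonneg hx)]
    exact_mod_cast hf x hx
  · change ¬ 0 ≤ F a
    rw [hF a hsa]
    exact_mod_cast not_le.2 hfa

theorem gnsSumRep_injective : Function.Injective (gnsSumRep A) := by
  classical
  rw [injective_iff_map_eq_zero]
  intro a ha
  by_contra hne
  have h1 : ¬ 0 ≤ -(star a * a) := by
    intro h
    have h2 : star a * a = 0 := le_antisymm (by simpa using h) (star_mul_self_nonneg a)
    exact hne (CStarRing.star_mul_self_eq_zero_iff a |>.1 h2)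
  obtain ⟨f, hf⟩ := exists_posFunctional h1 (IsSelfAdjoint.star_mul_self a).neg
  apply hf
  have h3 : f.gnsStarAlgHom a ((f.toPreGNS 1 : f.PreGNS) : f.GNS) = 0 := by
    have := congrArg (fun S => (S (lp.single 2 f ((f.toPreGNS 1 : f.PreGNS) : f.GNS))) f) ha
    simpa [gnsSumRep, l2Map_apply] using this
  have h4 : ((f.toPreGNS a : f.PreGNS) : f.GNS) = 0 := by
    rw [← h3, PositiveLinearMap.gnsStarAlgHom_apply]
    simp
  have h5 : ‖f.toPreGNS a‖ = 0 := by
    rw [← UniformSpace.Completion.norm_coe, h4, norm_zero]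
  have h6 := f.preGNS_norm_sq (f.toPreGNS a)
  rw [h5, PositiveLinearMap.ofPreGNS_toPreGNS] at h6
  rw [map_neg, ← h6]
  simp

variable {B : Type*} [CStarAlgebra B] [PartialOrder B] [StarOrderedRing B]

/-- The positive functional `f ∘ q`. -/
noncomputable def pullback (q : A →⋆ₐ[ℂ] B) (f : B →ₚ[ℂ] ℂ) : A →ₚ[ℂ] ℂ :=
  PositiveLinearMap.mk₀ (f.toLinearMap ∘ₗ q.toAlgHom.toLinearMap) fun x hx => by
    apply f.map_nonneg
    exact map_nonneg q hx

theorem pullback_apply (q : A →⋆ₐ[ℂ] B) (f : B →ₚ[ℂ] ℂ) (a : A) : pullback q f a = f (q a) := rfl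

theorem pullback_injective (q : A →⋆ₐ[ℂ] B) (hq : Function.Surjective q) :
    Function.Injective (pullback q) := by
  intro f g h
  ext b
  obtain ⟨a, rfl⟩ := hq b
  exact congrArg (fun k : A →ₚ[ℂ] ℂ => k a) h

/-- The isometry between pre-GNS spaces induced by `q`. -/
noncomputable def preGNSMap (q : A →⋆ₐ[ℂ] B) (f : B →ₚ[ℂ] ℂ) :
    (pullback q f).PreGNS →ₗᵢ[ℂ] f.PreGNS where
  toLinearMap := f.toPreGNS.toLinearMap ∘ₗ q.toAlgHom.toLinearMap ∘ₗ
    (pullback q f).ofPreGNS.toLinearMap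
  norm_map' x := by
    rw [PositiveLinearMap.preGNS_norm_def, PositiveLinearMap.preGNS_norm_def]
    rw [pullback_apply, map_mul q, map_star q]
    rfl

/-- The isometry `GNS (f ∘ q) → GNS f` induced by `q`. -/
noncomputable def gnsMap (q : A →⋆ₐ[ℂ] B) (f : B →ₚ[ℂ] ℂ) : (pullback q f).GNS →L[ℂ] f.GNS :=
  (preGNSMap q f).toContinuousLinearMap.completion

theorem gnsMap_coe (q : A →⋆ₐ[ℂ] B) (f : B →ₚ[ℂ] ℂ) (x : (pullback q f).PreGNS) :
    gnsMap q f x = (preGNSMap q f x : f.GNS) :=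
  ContinuousLinearMap.completion_apply_coe _ _

theorem norm_gnsMap (q : A →⋆ₐ[ℂ] B) (f : B →ₚ[ℂ] ℂ) (x : (pullback q f).GNS) :
    ‖gnsMap q f x‖ = ‖x‖ := by
  induction x using UniformSpace.Completion.induction_on with
  | hp => apply isClosed_eq <;> fun_prop
  | ih x => rw [gnsMap_coe, UniformSpace.Completion.norm_coe, UniformSpace.Completion.norm_coe,
      LinearIsometry.norm_map]

theorem gnsMap_comp_adjoint (q : A →⋆ₐ[ℂ] B) (hq : Function.Surjective q) (f : B →ₚ[ℂ] ℂ) :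
    gnsMap q f ∘L (gnsMap q f).adjoint = 1 := by
  have h1 : (gnsMap q f).adjoint ∘L gnsMap q f = 1 :=
    (ContinuousLinearMap.norm_map_iff_adjoint_comp_self _).1 (norm_gnsMap q f)
  ext y
  induction y using UniformSpace.Completion.induction_on with
  | hp => apply isClosed_eq <;> fun_prop
  | ih y =>
    obtain ⟨a, ha⟩ := hq (f.ofPreGNS y)
    have : (y : f.GNS) = gnsMap q f ((pullback q f).toPreGNS a : (pullback q f).PreGNS) := by
      rw [gnsMap_coe]
      congr 1
      change y = f.toPreGNS (q a)
      rw [ha]; rfl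
    rw [this]
    change gnsMap q f (((gnsMap q f).adjoint ∘L gnsMap q f) _) = _
    rw [h1]; rfl

theorem gnsMap_intertwine (q : A →⋆ₐ[ℂ] B) (f : B →ₚ[ℂ] ℂ) (a : A) (x : (pullback q f).GNS) :
    gnsMap q f ((pullback q f).gnsStarAlgHom a x) = f.gnsStarAlgHom (q a) (gnsMap q f x) := by
  induction x using UniformSpace.Completion.induction_on with
  | hp => apply isClosed_eq <;> fun_prop
  | ih x =>
    change gnsMap q f ((pullback q f).gnsNonUnitalStarAlgHom a x) =
      f.gnsNonUnitalStarAlgHom (q a) (gnsMap q f x)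
    rw [gnsMap_coe,
      PositiveLinearMap.gnsNonUnitalStarAlgHom_apply_coe,
      PositiveLinearMap.gnsNonUnitalStarAlgHom_apply_coe, gnsMap_coe]
    congr 1
    change f.toPreGNS (q (a * _)) = f.toPreGNS (q a * _)
    rw [map_mul]; rfl

/-- The coisometry between the sums of GNS spaces induced by a surjection `q`. -/
noncomputable def gnsSumMap (q : A →⋆ₐ[ℂ] B) (hq : Function.Surjective q) :
    lp (fun f : A →ₚ[ℂ] ℂ => f.GNS) 2 →L[ℂ] lp (fun f : B →ₚ[ℂ] ℂ => f.GNS) 2 :=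
  l2Map (pullback q) (pullback_injective q hq) (gnsMap q) 1
    (fun f => ContinuousLinearMap.opNorm_le_bound _ zero_le_one fun x => by
      rw [norm_gnsMap, one_mul])

theorem gnsSumMap_comp_adjoint (q : A →⋆ₐ[ℂ] B) (hq : Function.Surjective q) :
    gnsSumMap q hq ∘L (gnsSumMap q hq).adjoint = 1 :=
  l2Map_comp_adjoint _ _ _ _ _ (gnsMap_comp_adjoint q hq)

theorem gnsSumMap_intertwine (q : A →⋆ₐ[ℂ] B) (hq : Function.Surjective q) (a : A) :
    gnsSumMap q hq ∘L gnsSumRep A a = gnsSumRep B (q a) ∘L gnsSumMap q hq := by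
  ext ξ f
  exact gnsMap_intertwine q f a _

variable (A) in
/-- The Hilbert sum of the GNS spaces of all positive linear functionals. -/
def GnsSum : Type _ := lp (fun f : A →ₚ[ℂ] ℂ => f.GNS) 2

noncomputable instance : NormedAddCommGroup (GnsSum A) :=
  inferInstanceAs (NormedAddCommGroup (lp (fun f : A →ₚ[ℂ] ℂ => f.GNS) 2))

noncomputable instance : InnerProductSpace ℂ (GnsSum A) :=
  inferInstanceAs (InnerProductSpace ℂ (lp (fun f : A →ₚ[ℂ] ℂ => f.GNS) 2))

instance : CompleteSpace (GnsSum A) :=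
  inferInstanceAs (CompleteSpace (lp (fun f : A →ₚ[ℂ] ℂ => f.GNS) 2))

variable (A) in
/-- `gnsSumRep`, with values in the operators on `GnsSum A`. -/
noncomputable def gnsSumHom : A →⋆ₐ[ℂ] (GnsSum A →L[ℂ] GnsSum A) := gnsSumRep A

theorem gnsSumHom_injective : Function.Injective (gnsSumHom A) := gnsSumRep_injective

theorem exists_gnsSumMap (q : A →⋆ₐ[ℂ] B) (hq : Function.Surjective q) :
    ∃ V : GnsSum A →L[ℂ] GnsSum B, V ∘L V.adjoint = 1 ∧
      ∀ a, V ∘L gnsSumHom A a = gnsSumHom B (q a) ∘L V :=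
  ⟨gnsSumMap q hq, gnsSumMap_comp_adjoint q hq, gnsSumMap_intertwine q hq⟩

end Univ

section Wrap
variable (A : Type*) [CStarAlgebra A]

/-- The Hilbert space of the universal representation: the Hilbert sum of the GNS spaces of all
positive linear functionals, for the canonical order of the C⋆-algebra. -/
def UnivSpace : Type _ :=
  @GnsSum A _ (CStarAlgebra.spectralOrder A) (CStarAlgebra.spectralOrderedRing A)

noncomputable instance : NormedAddCommGroup (UnivSpace A) :=
  @instNormedAddCommGroupGnsSum A _ (CStarAlgebra.spectralOrder A) (CStarAlgebra.spectralOrderedRing A)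

noncomputable instance : InnerProductSpace ℂ (UnivSpace A) :=
  @instInnerProductSpaceComplexGnsSum A _ (CStarAlgebra.spectralOrder A) (CStarAlgebra.spectralOrderedRing A)

instance : CompleteSpace (UnivSpace A) :=
  @instCompleteSpaceGnsSum A _ (CStarAlgebra.spectralOrder A) (CStarAlgebra.spectralOrderedRing A)

/-- The universal representation of a C⋆-algebra, which is faithful. -/
noncomputable def univRep : A →⋆ₐ[ℂ] (UnivSpace A →L[ℂ] UnivSpace A) :=
  @gnsSumHom A _ (CStarAlgebra.spectralOrder A) (CStarAlgebra.spectralOrderedRing A)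

theorem univRep_injective : Function.Injective (univRep A) :=
  @gnsSumHom_injective A _ (CStarAlgebra.spectralOrder A) (CStarAlgebra.spectralOrderedRing A)

variable {A} {B : Type*} [CStarAlgebra B]

theorem exists_univMap (q : A →⋆ₐ[ℂ] B) (hq : Function.Surjective q) :
    ∃ V : UnivSpace A →L[ℂ] UnivSpace B, V ∘L V.adjoint = 1 ∧
      ∀ a, V ∘L univRep A a = univRep B (q a) ∘L V :=
  @exists_gnsSumMap A _ (CStarAlgebra.spectralOrder A) (CStarAlgebra.spectralOrderedRing A) B _
    (CStarAlgebra.spectralOrder B) (CStarAlgebra.spectralOrderedRing B) q hq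

end Wrap

section Conj
open scoped ComplexOrder InnerProductSpace
variable {H K : Type*} [NormedAddCommGroup H] [InnerProductSpace ℂ H] [CompleteSpace H]
  [NormedAddCommGroup K] [InnerProductSpace ℂ K] [CompleteSpace K]

theorem inner_map_map_of_unitary {u : H →L[ℂ] H} (hu : u ∈ unitary (H →L[ℂ] H)) (x y : H) :
    ⟪u x, u y⟫_ℂ = ⟪x, y⟫_ℂ := by
  have h : star u ∘L u = 1 := (Unitary.mem_iff.1 hu).1
  rw [← ContinuousLinearMap.adjoint_inner_left, ← ContinuousLinearMap.star_eq_adjoint,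
    ← ContinuousLinearMap.comp_apply, h]
  rfl

/-- `x` and `y` are intertwined by `W`, together with their adjoints. -/
def Intertwined (W : H →L[ℂ] K) (x : H →L[ℂ] H) (y : K →L[ℂ] K) : Prop :=
  W ∘L x = y ∘L W ∧ W ∘L star x = star y ∘L W

theorem Intertwined.of_unitary {W : H →L[ℂ] K} {x : H →L[ℂ] H} {y : K →L[ℂ] K}
    (hx : x ∈ unitary (H →L[ℂ] H)) (hy : y ∈ unitary (K →L[ℂ] K)) (h : W ∘L x = y ∘L W) :
    Intertwined W x y := by
  refine ⟨h, ?_⟩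
  have h1 : x ∘L star x = 1 := (Unitary.mem_iff.1 hx).2
  have h2 : star y ∘L y = 1 := (Unitary.mem_iff.1 hy).1
  calc W ∘L star x = (star y ∘L y) ∘L W ∘L star x := by rw [h2]; rfl
    _ = star y ∘L (y ∘L W) ∘L star x := rfl
    _ = star y ∘L W ∘L (x ∘L star x) := by rw [← h]; rfl
    _ = star y ∘L W := by rw [h1]; rfl

theorem exists_intertwined {W : H →L[ℂ] K} {X : Set (H →L[ℂ] H)}
    {T : StarSubalgebra ℂ (K →L[ℂ] K)} (hX : ∀ x ∈ X, ∃ y ∈ T, Intertwined W x y)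
    {x : H →L[ℂ] H} (hx : x ∈ StarAlgebra.adjoin ℂ X) : ∃ y ∈ T, Intertwined W x y := by
  induction hx using StarAlgebra.adjoin_induction with
  | mem x h => exact hX x h
  | algebraMap r =>
    refine ⟨algebraMap ℂ _ r, algebraMap_mem _ r, ?_, ?_⟩
    · ext1 ξ; simp [Algebra.algebraMap_eq_smul_one]
    · ext1 ξ; simp [Algebra.algebraMap_eq_smul_one]
  | add x x' _ _ hx hx' =>
    obtain ⟨y, hy, h1, h2⟩ := hx
    obtain ⟨y', hy', h1', h2'⟩ := hx'
    refine ⟨y + y', add_mem hy hy', ?_, ?_⟩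
    · rw [ContinuousLinearMap.comp_add, ContinuousLinearMap.add_comp, h1, h1']
    · rw [star_add, star_add, ContinuousLinearMap.comp_add, ContinuousLinearMap.add_comp, h2, h2']
  | mul x x' _ _ hx hx' =>
    obtain ⟨y, hy, h1, h2⟩ := hx
    obtain ⟨y', hy', h1', h2'⟩ := hx'
    refine ⟨y * y', mul_mem hy hy', ?_, ?_⟩
    · calc W ∘L (x * x') = (W ∘L x) ∘L x' := rfl
        _ = y ∘L (W ∘L x') := by rw [h1]; rfl
        _ = _ := by rw [h1']; rfl
    · rw [star_mul, star_mul]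
      calc W ∘L (star x' * star x) = (W ∘L star x') ∘L star x := rfl
        _ = star y' ∘L (W ∘L star x) := by rw [h2']; rfl
        _ = _ := by rw [h2]; rfl
  | star x _ hx =>
    obtain ⟨y, hy, h1, h2⟩ := hx
    exact ⟨star y, star_mem hy, h2, by rwa [star_star, star_star]⟩

variable {W : H →L[ℂ] K} (hW : W ∘L W.adjoint = 1) {X : Set (H →L[ℂ] H)}
  {T : StarSubalgebra ℂ (K →L[ℂ] K)} (hT : IsClosed (T : Set (K →L[ℂ] K)))
  (hX : ∀ x ∈ X, ∃ y ∈ T, Intertwined W x y)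

theorem conj_eq_of_intertwined (hW : W ∘L W.adjoint = 1) {x : H →L[ℂ] H} {y : K →L[ℂ] K}
    (h : W ∘L x = y ∘L W) : W ∘L x ∘L W.adjoint = y := by
  rw [← ContinuousLinearMap.comp_assoc, h, ContinuousLinearMap.comp_assoc, hW]
  rfl

theorem conjHom_mem_aux (hW : W ∘L W.adjoint = 1) (hT : IsClosed (T : Set (K →L[ℂ] K)))
    (hX : ∀ x ∈ X, ∃ y ∈ T, Intertwined W x y) {x : H →L[ℂ] H}
    (hx : x ∈ (StarAlgebra.adjoin ℂ X).topologicalClosure) : W ∘L x ∘L W.adjoint ∈ T := by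
  refine closure_minimal (t := (fun x => W ∘L x ∘L W.adjoint) ⁻¹' T) ?_
    (hT.preimage (by fun_prop)) hx
  intro x hx
  obtain ⟨y, hy, h1, -⟩ := exists_intertwined hX hx
  rwa [Set.mem_preimage, conj_eq_of_intertwined hW h1]

theorem conjHom_comm_aux (hX : ∀ x ∈ X, ∃ y ∈ T, Intertwined W x y) {x : H →L[ℂ] H}
    (hx : x ∈ (StarAlgebra.adjoin ℂ X).topologicalClosure) :
    W.adjoint ∘L W ∘L x = x ∘L W.adjoint ∘L W := by
  refine closure_minimal (t := {x | W.adjoint ∘L W ∘L x = x ∘L W.adjoint ∘L W}) ?_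
    (isClosed_eq (by fun_prop) (by fun_prop)) hx
  intro x hx
  obtain ⟨y, -, h1, h2⟩ := exists_intertwined hX hx
  have h3 := congrArg ContinuousLinearMap.adjoint h2
  rw [ContinuousLinearMap.adjoint_comp, ContinuousLinearMap.adjoint_comp,
    ContinuousLinearMap.star_eq_adjoint, ContinuousLinearMap.star_eq_adjoint,
    ContinuousLinearMap.adjoint_adjoint, ContinuousLinearMap.adjoint_adjoint] at h3
  rw [Set.mem_ofPred_eq, h1, ← ContinuousLinearMap.comp_assoc, ← h3,
    ContinuousLinearMap.comp_assoc]

theorem conjHom_mul_aux (hW : W ∘L W.adjoint = 1) {x y : H →L[ℂ] H}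
    (hy : W.adjoint ∘L W ∘L y = y ∘L W.adjoint ∘L W) :
    W ∘L (x * y) ∘L W.adjoint = (W ∘L x ∘L W.adjoint) * (W ∘L y ∘L W.adjoint) := by
  calc W ∘L (x * y) ∘L W.adjoint
      = W ∘L x ∘L y ∘L W.adjoint ∘L (W ∘L W.adjoint) := by rw [hW]; rfl
    _ = W ∘L x ∘L (y ∘L W.adjoint ∘L W) ∘L W.adjoint := rfl
    _ = _ := by rw [← hy]; rfl

theorem conjHom_star_aux (x : H →L[ℂ] H) :
    W ∘L (star x) ∘L W.adjoint = star (W ∘L x ∘L W.adjoint) := by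
  rw [ContinuousLinearMap.star_eq_adjoint, ContinuousLinearMap.star_eq_adjoint,
    ContinuousLinearMap.adjoint_comp, ContinuousLinearMap.adjoint_comp,
    ContinuousLinearMap.adjoint_adjoint, ContinuousLinearMap.comp_assoc]

/-- If every generator in `X` is intertwined by the coisometry `W` with an element of `T`, then
`x ↦ W x W*` is a ⋆-homomorphism from the C⋆-algebra generated by `X` to `T`. -/
noncomputable def conjHom : (StarAlgebra.adjoin ℂ X).topologicalClosure →⋆ₐ[ℂ] T where
  toFun x := ⟨W ∘L x.1 ∘L W.adjoint, conjHom_mem_aux hW hT hX x.2⟩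
  map_one' := Subtype.ext hW
  map_mul' x y := Subtype.ext (conjHom_mul_aux hW (conjHom_comm_aux hX y.2))
  map_zero' := Subtype.ext (by ext1 ξ; simp)
  map_add' x y := Subtype.ext (by ext1 ξ; simp)
  commutes' r := Subtype.ext (conj_eq_of_intertwined hW (by
    ext1 ξ; simp [Algebra.algebraMap_eq_smul_one]))
  map_star' x := Subtype.ext (conjHom_star_aux x.1)

theorem conjHom_eq {x : (StarAlgebra.adjoin ℂ X).topologicalClosure} {y : T}
    (h : W ∘L x.1 = y.1 ∘L W) : conjHom hW hT hX x = y :=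
  Subtype.ext (conj_eq_of_intertwined hW h)

end Conj

universe u v

/-- A twisted action of a discrete group `G` on a unital C⋆-algebra `A`, i.e. the data of a twisted
unital discrete C⋆-dynamical system `(A, G, α, σ)`. -/
structure TwistedSystem (A : Type u) (G : Type v) [CStarAlgebra A] [Group G] where
  α : G → (A ≃⋆ₐ[ℂ] A)
  σ : G → G → unitary A
  α_comp : ∀ g h a, α g (α h a) = (σ g h : A) * α (g * h) a * star (σ g h : A)
  cocycle : ∀ g h k, (σ g h : A) * (σ (g * h) k : A) = α g (σ h k : A) * (σ g (h * k) : A)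
  σ_one_right : ∀ g, σ g 1 = 1
  σ_one_left : ∀ g, σ 1 g = 1

namespace TwistedSystem

section Regular
open scoped ComplexOrder InnerProductSpace
variable {A : Type u} {G : Type v} [CStarAlgebra A] [Group G] (S : TwistedSystem A G)

theorem α_one (a : A) : S.α 1 a = a := by
  have hinj : Function.Injective (S.α 1) := EquivLike.injective (S.α 1)
  apply hinj
  rw [S.α_comp, S.σ_one_left]
  simp

variable (A G) in
/-- The Hilbert space `ℓ²(G, H)`, where `H` is the space of the universal representation. -/
abbrev HilbertSpace : Type _ := lp (fun _ : G => UnivSpace A) 2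

theorem regA_bound (a : A) (h : G) : ‖univRep A (S.α h⁻¹ a)‖ ≤ ‖a‖ :=
  (NonUnitalStarAlgHom.norm_apply_le (univRep A) _).trans
    (NonUnitalStarAlgHom.norm_apply_le (S.α h⁻¹) a)

/-- The representation `(π(a) ξ)(h) = α_{h⁻¹}(a) ξ(h)` of `A` on `ℓ²(G, H)`. -/
noncomputable def regA : A →⋆ₐ[ℂ] (HilbertSpace A G →L[ℂ] HilbertSpace A G) where
  toFun a := l2Map id Function.injective_id (fun h => univRep A (S.α h⁻¹ a)) ‖a‖ (S.regA_bound a)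
  map_one' := by ext ξ h; rw [l2Map_apply, map_one, map_one]; rfl
  map_mul' a b := by
    ext ξ h; simp only [mul_apply_eq_comp, l2Map_apply, map_mul]; rfl
  map_zero' := by ext ξ h; rw [l2Map_apply, map_zero, map_zero]; rfl
  map_add' a b := by
    ext ξ h; rw [l2Map_apply, map_add, map_add]; rfl
  commutes' c := by
    ext ξ h
    rw [l2Map_apply, Algebra.algebraMap_eq_smul_one, map_smul, map_smul, map_one, map_one]
    rfl
  map_star' a := by
    rw [ContinuousLinearMap.star_eq_adjoint]
    symm
    apply adjoint_l2Map_diag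
    intro h
    rw [map_star, map_star, ContinuousLinearMap.star_eq_adjoint]

theorem regA_apply (a : A) (ξ : HilbertSpace A G) (h : G) :
    S.regA a ξ h = univRep A (S.α h⁻¹ a) (ξ h) := rfl

theorem regG_bound (g h : G) : ‖univRep A (S.σ h⁻¹ g : A)‖ ≤ 1 := by
  have h1 := CStarRing.norm_coe_unitary_mul
    ⟨univRep A (S.σ h⁻¹ g : A), Unitary.map_mem (univRep A) (S.σ h⁻¹ g).2⟩ 1
  simp only [mul_one] at h1
  rw [h1]
  exact ContinuousLinearMap.norm_id_le

/-- The operators `(λ(g) ξ)(h) = σ(h⁻¹, g) ξ(g⁻¹ h)` on `ℓ²(G, H)`. -/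
noncomputable def regG (g : G) : HilbertSpace A G →L[ℂ] HilbertSpace A G :=
  l2Map (fun h => g⁻¹ * h) (mul_right_injective g⁻¹) (fun h => univRep A (S.σ h⁻¹ g : A)) 1
    (S.regG_bound g)

theorem regG_apply (g : G) (ξ : HilbertSpace A G) (h : G) :
    S.regG g ξ h = univRep A (S.σ h⁻¹ g : A) (ξ (g⁻¹ * h)) := rfl

theorem regG_mul_regA (g : G) (a : A) : S.regG g * S.regA a = S.regA (S.α g a) * S.regG g := by
  ext ξ h
  simp only [mul_apply_eq_comp, regG_apply, regA_apply]
  rw [← mul_apply_eq_comp, ← mul_apply_eq_comp, ← map_mul, ← map_mul, S.α_comp]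
  simp [mul_assoc]

theorem regG_mul_regG (g k : G) : S.regG g * S.regG k = S.regA (S.σ g k) * S.regG (g * k) := by
  ext ξ h
  simp only [mul_apply_eq_comp, regG_apply, regA_apply]
  rw [← mul_apply_eq_comp, ← mul_apply_eq_comp, ← map_mul, ← map_mul, ← S.cocycle]
  simp [mul_assoc]

theorem regG_one : S.regG 1 = 1 := by
  ext ξ h
  rw [regG_apply, S.σ_one_right]
  simp

theorem isUnitary_regG (g : G) : S.regG g ∈ unitary (HilbertSpace A G →L[ℂ] HilbertSpace A G) := by
  have h1 : star (S.regG g) * S.regG g = 1 := by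
    rw [ContinuousLinearMap.star_eq_adjoint]
    ext1 ξ
    refine ext_inner_right ℂ fun η => ?_
    rw [mul_apply_eq_comp, ContinuousLinearMap.adjoint_inner_left, lp.inner_eq_tsum, lp.inner_eq_tsum]
    have h0 : ∀ h, ⟪S.regG g ξ h, S.regG g η h⟫_ℂ = ⟪ξ (g⁻¹ * h), η (g⁻¹ * h)⟫_ℂ := fun h => by
      exact inner_map_map_of_unitary (Unitary.map_mem (univRep A) (S.σ h⁻¹ g).2) _ _
    exact (tsum_congr h0).trans ((Equiv.mulLeft g⁻¹).tsum_eq (fun h => ⟪ξ h, η h⟫_ℂ))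
  have h2 : S.regG g * (S.regG g⁻¹ * S.regA (star (S.σ g g⁻¹ : A))) = 1 := by
    rw [← mul_assoc, regG_mul_regG, mul_inv_cancel, regG_one, mul_one, ← map_mul]
    simp
  have h3 : star (S.regG g) = S.regG g⁻¹ * S.regA (star (S.σ g g⁻¹ : A)) := left_inv_eq_right_inv h1 h2
  exact Unitary.mem_iff.2 ⟨h1, by rw [h3, h2]⟩

theorem star_regG (g : G) : star (S.regG g) = S.regA (star (S.σ g⁻¹ g : A)) * S.regG g⁻¹ := by
  refine (left_inv_eq_right_inv ?_ (Unitary.mem_iff.1 (S.isUnitary_regG g)).2).symm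
  rw [mul_assoc, regG_mul_regG, inv_mul_cancel, regG_one, mul_one, ← map_mul]
  simp

/-- The C⋆-algebra of operators generated by `π(A)` and `λ(G)`. -/
noncomputable def reducedAlgebra : StarSubalgebra ℂ (HilbertSpace A G →L[ℂ] HilbertSpace A G) :=
  (StarAlgebra.adjoin ℂ (Set.range S.regA ∪ Set.range S.regG)).topologicalClosure

theorem isClosed_reducedAlgebra :
    IsClosed (S.reducedAlgebra : Set (HilbertSpace A G →L[ℂ] HilbertSpace A G)) :=
  StarSubalgebra.isClosed_topologicalClosure _

/-- The reduced twisted crossed product `C_r^*(Σ)`. -/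
def ReducedCrossedProduct : Type _ := S.reducedAlgebra

noncomputable instance : CStarAlgebra S.ReducedCrossedProduct :=
  haveI := S.isClosed_reducedAlgebra
  inferInstanceAs (CStarAlgebra S.reducedAlgebra)

/-- The inclusion of the reduced crossed product in the bounded operators. -/
noncomputable def incl : S.ReducedCrossedProduct →⋆ₐ[ℂ] (HilbertSpace A G →L[ℂ] HilbertSpace A G) :=
  S.reducedAlgebra.subtype

theorem regA_mem (a : A) : S.regA a ∈ S.reducedAlgebra :=
  StarSubalgebra.le_topologicalClosure _ (StarAlgebra.subset_adjoin _ _ (Or.inl ⟨a, rfl⟩))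

theorem regG_mem (g : G) : S.regG g ∈ S.reducedAlgebra :=
  StarSubalgebra.le_topologicalClosure _ (StarAlgebra.subset_adjoin _ _ (Or.inr ⟨g, rfl⟩))

/-- The embedding of `A` in the reduced crossed product. -/
noncomputable def ι : A →⋆ₐ[ℂ] S.ReducedCrossedProduct :=
  StarAlgHom.codRestrict S.regA S.reducedAlgebra S.regA_mem

/-- The canonical unitaries `λ(g)` of the reduced crossed product. -/
noncomputable def lam (g : G) : unitary S.ReducedCrossedProduct :=
  ⟨(⟨S.regG g, S.regG_mem g⟩ : S.reducedAlgebra), Unitary.mem_iff.2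
    ⟨Subtype.ext (Unitary.mem_iff.1 (S.isUnitary_regG g)).1,
     Subtype.ext (Unitary.mem_iff.1 (S.isUnitary_regG g)).2⟩⟩

theorem lam_mul_ι (g : G) (a : A) :
    (S.lam g : S.ReducedCrossedProduct) * S.ι a = S.ι (S.α g a) * S.lam g :=
  Subtype.ext (S.regG_mul_regA g a)

theorem lam_mul_lam (g h : G) :
    (S.lam g : S.ReducedCrossedProduct) * S.lam h = S.ι (S.σ g h) * S.lam (g * h) :=
  Subtype.ext (S.regG_mul_regG g h)

open Classical in
/-- The matrix coefficient of an operator on `ℓ²(G, H)` at `(e, e)`, an operator on `H`. -/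
noncomputable def compression :
    (HilbertSpace A G →L[ℂ] HilbertSpace A G) →ₗ[ℂ] (UnivSpace A →L[ℂ] UnivSpace A) where
  toFun x := lp.evalCLM ℂ (fun _ : G => UnivSpace A) 2 1 ∘L x ∘L
    lp.singleContinuousLinearMap ℂ (fun _ : G => UnivSpace A) 2 1
  map_add' x y := by ext v; simp
  map_smul' c x := by ext v; simp

open Classical in
theorem compression_apply (x : HilbertSpace A G →L[ℂ] HilbertSpace A G) (v : UnivSpace A) :
    compression x v = x (lp.single 2 1 v) 1 := rfl

theorem continuous_compression : Continuous (compression (A := A) (G := G)) := by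
  change Continuous fun x => lp.evalCLM ℂ (fun _ : G => UnivSpace A) 2 1 ∘L x ∘L _
  fun_prop

theorem mem_span_of_mem_adjoin {x : HilbertSpace A G →L[ℂ] HilbertSpace A G}
    (hx : x ∈ StarAlgebra.adjoin ℂ (Set.range S.regA ∪ Set.range S.regG)) :
    x ∈ Submodule.span ℂ (Set.range fun p : A × G => S.regA p.1 * S.regG p.2) := by
  have hgen : ∀ a g, S.regA a * S.regG g ∈
      Submodule.span ℂ (Set.range fun p : A × G => S.regA p.1 * S.regG p.2) :=
    fun a g => Submodule.subset_span ⟨(a, g), rfl⟩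
  induction hx using StarAlgebra.adjoin_induction with
  | mem x h =>
    rcases h with ⟨a, rfl⟩ | ⟨g, rfl⟩
    · simpa [regG_one] using hgen a 1
    · simpa using hgen 1 g
  | algebraMap r =>
    rw [Algebra.algebraMap_eq_smul_one]
    refine Submodule.smul_mem _ _ ?_
    simpa [regG_one] using hgen 1 1
  | add x y _ _ hx hy => exact add_mem hx hy
  | mul x y hxm hym hx hy =>
    clear hxm hym
    induction hx using Submodule.span_induction with
    | zero => simp
    | add x x' _ _ hx hx' => rw [add_mul]; exact add_mem hx hx'
    | smul c x _ hx => rw [smul_mul_assoc]; exact Submodule.smul_mem _ _ hx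
    | mem x hx =>
      obtain ⟨⟨a, g⟩, rfl⟩ := hx
      induction hy using Submodule.span_induction with
      | zero => simp
      | add x x' _ _ hx hx' => rw [mul_add]; exact add_mem hx hx'
      | smul c x _ hx => rw [mul_smul_comm]; exact Submodule.smul_mem _ _ hx
      | mem y hy =>
        obtain ⟨⟨b, h⟩, rfl⟩ := hy
        have : S.regA a * S.regG g * (S.regA b * S.regG h)
            = S.regA (a * S.α g b * S.σ g h) * S.regG (g * h) := by
          rw [mul_assoc, ← mul_assoc (S.regG g), regG_mul_regA, mul_assoc _ (S.regG g),
            regG_mul_regG, map_mul, map_mul]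
          simp only [mul_assoc]
        simpa only [this] using hgen _ _
  | star x hxm hx =>
    clear hxm
    induction hx using Submodule.span_induction with
    | zero => simp
    | add x x' _ _ hx hx' => rw [star_add]; exact add_mem hx hx'
    | smul c x _ hx => rw [star_smul]; exact Submodule.smul_mem _ _ hx
    | mem x hx =>
      obtain ⟨⟨a, g⟩, rfl⟩ := hx
      simp only [star_mul, star_regG]
      rw [← map_star, mul_assoc, regG_mul_regA, ← mul_assoc, ← map_mul]
      exact hgen _ _

theorem compression_mem_range (x : S.ReducedCrossedProduct) :
    compression (S.incl x) ∈ (univRep A).toAlgHom.toLinearMap.range := by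
  classical
  have hcl : IsClosed ((univRep A).toAlgHom.toLinearMap.range :
      Set (UnivSpace A →L[ℂ] UnivSpace A)) :=
    (NonUnitalStarAlgHom.isometry (univRep A) (univRep_injective A)).isClosedEmbedding.isClosed_range
  have hx : S.incl x ∈ closure (StarAlgebra.adjoin ℂ (Set.range S.regA ∪ Set.range S.regG) :
      Set (HilbertSpace A G →L[ℂ] HilbertSpace A G)) :=
    Subtype.property (p := fun y => y ∈ S.reducedAlgebra) x
  refine closure_minimal (t := compression ⁻¹' _) ?_ (hcl.preimage continuous_compression) hx
  intro y hy
  have hy' := S.mem_span_of_mem_adjoin hy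
  change y ∈ Submodule.comap compression (univRep A).toAlgHom.toLinearMap.range
  refine Submodule.span_le.2 ?_ hy'
  rintro _ ⟨⟨a, g⟩, rfl⟩
  by_cases hg : g = 1
  · subst hg
    refine ⟨a, ?_⟩
    ext v
    rw [compression_apply]
    simp [regG_one, regA_apply, α_one]
  · refine ⟨0, ?_⟩
    ext v
    rw [compression_apply]
    simp [regG_apply, regA_apply, Pi.single_eq_of_ne (show g⁻¹ ≠ 1 by simpa using hg)]

/-- The canonical conditional expectation `E : C_r^*(Σ) → A`: the coefficient at the identity,
read in `A` through the faithful representation. -/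
noncomputable def E : S.ReducedCrossedProduct →ₗ[ℂ] A :=
  (LinearEquiv.ofInjective (univRep A).toAlgHom.toLinearMap (univRep_injective A)).symm.toLinearMap ∘ₗ
    LinearMap.codRestrict _ (compression ∘ₗ S.incl.toAlgHom.toLinearMap) S.compression_mem_range

theorem univRep_E (x : S.ReducedCrossedProduct) : univRep A (S.E x) = compression (S.incl x) :=
  congrArg Subtype.val ((LinearEquiv.ofInjective (univRep A).toAlgHom.toLinearMap
    (univRep_injective A)).apply_symm_apply ⟨_, S.compression_mem_range x⟩)

theorem E_ι (a : A) : S.E (S.ι a) = a := by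
  classical
  apply univRep_injective A
  rw [univRep_E]
  ext v
  rw [compression_apply]
  change S.regA a _ 1 = _
  simp [regA_apply, α_one]

theorem E_ι_mul_lam (a : A) {g : G} (hg : g ≠ 1) : S.E (S.ι a * S.lam g) = 0 := by
  classical
  apply univRep_injective A
  rw [univRep_E]
  ext v
  rw [compression_apply]
  change S.regA a (S.regG g _) 1 = _
  simp [regG_apply, regA_apply, Pi.single_eq_of_ne (show g⁻¹ ≠ 1 by simpa using hg)]

end Regular

section Functorial
variable {A B : Type u} {G : Type v} [CStarAlgebra A] [CStarAlgebra B] [Group G]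
  (S : TwistedSystem A G) (S' : TwistedSystem B G)

/-- A surjective ⋆-homomorphism which carries one twisted action to another. -/
structure IsEquivariantSurjection (q : A →⋆ₐ[ℂ] B) : Prop where
  surjective : Function.Surjective q
  map_α : ∀ g a, q (S.α g a) = S'.α g (q a)
  map_σ : ∀ g h, q (S.σ g h) = S'.σ g h

variable {S S'} {q : A →⋆ₐ[ℂ] B}

theorem exists_intertwiner (hq : IsEquivariantSurjection S S' q) :
    ∃ W : HilbertSpace A G →L[ℂ] HilbertSpace B G, W ∘L W.adjoint = 1 ∧
      (∀ a, W ∘L S.regA a = S'.regA (q a) ∘L W) ∧ ∀ g, W ∘L S.regG g = S'.regG g ∘L W := by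
  obtain ⟨V, hV, hVr⟩ := exists_univMap q hq.surjective
  refine ⟨l2Map id Function.injective_id (fun _ => V) ‖V‖ (fun _ => le_rfl),
    l2Map_comp_adjoint _ _ _ _ _ (fun _ => hV), fun a => ?_, fun g => ?_⟩
  · ext1 ξ
    ext h
    change (V ∘L univRep A (S.α h⁻¹ a)) (ξ h) = univRep B (S'.α h⁻¹ (q a)) (V (ξ h))
    rw [hVr, hq.map_α]
    rfl
  · ext1 ξ
    ext h
    change (V ∘L univRep A (S.σ h⁻¹ g : A)) (ξ (g⁻¹ * h)) =
      univRep B (S'.σ h⁻¹ g : B) (V (ξ (g⁻¹ * h)))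
    rw [hVr, hq.map_σ]
    rfl

/-- A coisometry `ℓ²(G, H_A) → ℓ²(G, H_B)` intertwining the regular representations. -/
noncomputable def intertwiner (hq : IsEquivariantSurjection S S' q) :
    HilbertSpace A G →L[ℂ] HilbertSpace B G := (exists_intertwiner hq).choose

theorem intertwiner_comp_adjoint (hq : IsEquivariantSurjection S S' q) :
    intertwiner hq ∘L (intertwiner hq).adjoint = 1 :=
  (exists_intertwiner hq).choose_spec.1

theorem intertwiner_regA (hq : IsEquivariantSurjection S S' q) (a : A) :
    intertwiner hq ∘L S.regA a = S'.regA (q a) ∘L intertwiner hq :=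
  (exists_intertwiner hq).choose_spec.2.1 a

theorem intertwiner_regG (hq : IsEquivariantSurjection S S' q) (g : G) :
    intertwiner hq ∘L S.regG g = S'.regG g ∘L intertwiner hq :=
  (exists_intertwiner hq).choose_spec.2.2 g

theorem intertwiner_generators (hq : IsEquivariantSurjection S S' q) :
    ∀ x ∈ Set.range S.regA ∪ Set.range S.regG,
      ∃ y ∈ S'.reducedAlgebra, Intertwined (intertwiner hq) x y := by
  rintro _ (⟨a, rfl⟩ | ⟨g, rfl⟩)
  · refine ⟨S'.regA (q a), S'.regA_mem _, intertwiner_regA hq a, ?_⟩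
    rw [← map_star, ← map_star, ← map_star, intertwiner_regA]
  · exact ⟨S'.regG g, S'.regG_mem g, .of_unitary (S.isUnitary_regG g) (S'.isUnitary_regG g)
      (intertwiner_regG hq g)⟩

/-- The ⋆-homomorphism of reduced crossed products induced by an equivariant surjection; it is
determined by its values on the generators, computed below. -/
noncomputable def map (hq : IsEquivariantSurjection S S' q) :
    S.ReducedCrossedProduct →⋆ₐ[ℂ] S'.ReducedCrossedProduct :=
  conjHom (intertwiner_comp_adjoint hq) S'.isClosed_reducedAlgebra (intertwiner_generators hq)

theorem map_ι (hq : IsEquivariantSurjection S S' q) (a : A) : map hq (S.ι a) = S'.ι (q a) :=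
  conjHom_eq _ _ _ (intertwiner_regA hq a)

theorem map_lam (hq : IsEquivariantSurjection S S' q) (g : G) : map hq (S.lam g) = S'.lam g :=
  conjHom_eq _ _ _ (intertwiner_regG hq g)

end Functorial
end TwistedSystem

namespace ClosedIdeal

/-- An algebra homomorphism vanishing on a closed ideal factors through the quotient. -/
noncomputable def liftAlg {A B : Type*} [CStarAlgebra A] [CStarAlgebra B] (J : ClosedIdeal A)
    (φ : A →ₐ[ℂ] B) (h : ∀ a ∈ J, φ a = 0) : J.Quot →ₐ[ℂ] B :=
  haveI := J.isTwoSided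
  Ideal.Quotient.liftₐ J.toIdeal φ h

/-- A ⋆-homomorphism vanishing on a closed ideal factors through the quotient. -/
noncomputable def lift {A B : Type*} [CStarAlgebra A] [CStarAlgebra B] (J : ClosedIdeal A)
    (φ : A →⋆ₐ[ℂ] B) (h : ∀ a ∈ J, φ a = 0) : J.Quot →⋆ₐ[ℂ] B where
  __ := J.liftAlg φ.toAlgHom h
  map_star' x := by
    obtain ⟨a, rfl⟩ := J.mkAlg_surjective x
    exact map_star φ a

theorem lift_quotMap {A B : Type*} [CStarAlgebra A] [CStarAlgebra B] (J : ClosedIdeal A)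
    (φ : A →⋆ₐ[ℂ] B) (h : ∀ a ∈ J, φ a = 0) (a : A) : J.lift φ h (J.quotMap a) = φ a := rfl

theorem quotMap_surjective {A : Type*} [CStarAlgebra A] (J : ClosedIdeal A) :
    Function.Surjective J.quotMap := J.mkAlg_surjective

theorem quotMap_eq_zero_iff {A : Type*} [CStarAlgebra A] (J : ClosedIdeal A) {a : A} :
    J.quotMap a = 0 ↔ a ∈ J := J.mkAlg_eq_zero_iff

end ClosedIdeal

/-- A C⋆-algebra is simple if it is nonzero and has no closed two-sided ideals other than `0` and
itself. -/
def IsSimpleCStarAlgebra (B : Type*) [CStarAlgebra B] : Prop :=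
  Nontrivial B ∧ ∀ I : ClosedIdeal B, (I : Set B) = {0} ∨ (I : Set B) = Set.univ

namespace TwistedSystem
variable {A : Type u} {G : Type v} [CStarAlgebra A] [Group G] (S : TwistedSystem A G)

/-- Invariance of an ideal: `α_g(J) = J` for all `g`. -/
def IsInvariant (J : ClosedIdeal A) : Prop := ∀ g, S.α g '' (J : Set A) = J

variable {S} in
theorem IsInvariant.map_mem_iff {J : ClosedIdeal A} (hJ : S.IsInvariant J) (g : G) {a : A} :
    S.α g a ∈ J ↔ a ∈ J := by
  have hinj : Function.Injective (S.α g) := EquivLike.injective (S.α g)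
  have h := hinj.mem_set_image (s := (J : Set A)) (a := a)
  rw [hJ g] at h
  exact h

/-- The automorphism of `A/J` induced by `α_g`. -/
noncomputable def quotientα (J : ClosedIdeal A) (hJ : S.IsInvariant J) (g : G) :
    J.Quot ≃⋆ₐ[ℂ] J.Quot :=
  StarAlgEquiv.ofStarAlgHom
    (J.lift (J.quotMap.comp (S.α g : A →⋆ₐ[ℂ] A)) fun _ ha =>
      J.quotMap_eq_zero_iff.2 ((hJ.map_mem_iff g).2 ha))
    (J.lift (J.quotMap.comp ((S.α g).symm : A →⋆ₐ[ℂ] A)) fun a ha =>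
      J.quotMap_eq_zero_iff.2 ((hJ.map_mem_iff g).1 (by
        change S.α g ((S.α g).symm a) ∈ J
        rwa [StarAlgEquiv.apply_symm_apply])))
    (by
      ext x
      obtain ⟨a, rfl⟩ := J.quotMap_surjective x
      change J.quotMap ((S.α g).symm (S.α g a)) = J.quotMap a
      rw [StarAlgEquiv.symm_apply_apply])
    (by
      ext x
      obtain ⟨a, rfl⟩ := J.quotMap_surjective x
      change J.quotMap (S.α g ((S.α g).symm a)) = J.quotMap a
      rw [StarAlgEquiv.apply_symm_apply])

theorem quotientα_quotMap (J : ClosedIdeal A) (hJ : S.IsInvariant J) (g : G) (a : A) :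
    S.quotientα J hJ g (J.quotMap a) = J.quotMap (S.α g a) := rfl

/-- The quotient system `Σ/J = (A/J, G, α̇, σ̇)`. -/
noncomputable def quotient (J : ClosedIdeal A) (hJ : S.IsInvariant J) :
    TwistedSystem J.Quot G where
  α := S.quotientα J hJ
  σ g h := ⟨J.quotMap (S.σ g h), Unitary.map_mem J.quotMap (S.σ g h).2⟩
  α_comp g h x := by
    obtain ⟨a, rfl⟩ := J.quotMap_surjective x
    simp only [quotientα_quotMap, S.α_comp, map_mul, map_star]
  cocycle g h k := by
    simp only [quotientα_quotMap, ← map_mul, S.cocycle]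
  σ_one_right g := Subtype.ext (by simp [S.σ_one_right])
  σ_one_left g := Subtype.ext (by simp [S.σ_one_left])

theorem isEquivariantSurjection_quotMap (J : ClosedIdeal A) (hJ : S.IsInvariant J) :
    IsEquivariantSurjection S (S.quotient J hJ) J.quotMap where
  surjective := J.quotMap_surjective
  map_α _ _ := rfl
  map_σ _ _ := rfl

/-- The canonical ⋆-homomorphism `C_r^*(Σ) → C_r^*(Σ/J)`, with `a ↦ a + J` and
`λ(g) ↦ λ(g)`. -/
noncomputable def quotientHom (J : ClosedIdeal A) (hJ : S.IsInvariant J) :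
    S.ReducedCrossedProduct →⋆ₐ[ℂ] (S.quotient J hJ).ReducedCrossedProduct :=
  map (S.isEquivariantSurjection_quotMap J hJ)

/-- The induced ideal `⟨J⟩`: the closed two-sided ideal of `C_r^*(Σ)` generated by `J`. -/
noncomputable def induced (J : ClosedIdeal A) : ClosedIdeal S.ReducedCrossedProduct :=
  ClosedIdeal.generated (S.ι '' (J : Set A))

/-- `Σ` is exact: for every invariant ideal `J`, the ideal `⟨J⟩` is the kernel of the canonical
⋆-homomorphism `C_r^*(Σ) → C_r^*(Σ/J)`. -/
def IsExact : Prop :=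
  ∀ (J : ClosedIdeal A) (hJ : S.IsInvariant J),
    (S.induced J : Set S.ReducedCrossedProduct) = {x | S.quotientHom J hJ x = 0}

/-- Property (DP): `0` is in the norm closure of the convex hull of the unitary conjugates of every
self-adjoint `y` with `E(y) = 0`. -/
def HasDP : Prop :=
  ∀ y : S.ReducedCrossedProduct, star y = y → S.E y = 0 →
    (0 : S.ReducedCrossedProduct) ∈ closure (convexHull ℝ
      {z | ∃ v ∈ unitary S.ReducedCrossedProduct, z = v * y * star v})

/-- Maximal elements among the proper invariant ideals of `A`. -/
def IsMaximalInvariant (J : ClosedIdeal A) : Prop :=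
  Maximal (fun K : ClosedIdeal A => S.IsInvariant K ∧ (K : Set A) ≠ Set.univ) J

end TwistedSystem

/-! The conditional expectation `E` is equivariant, so for an ideal `I` of the crossed product the
closure `J` of `E(I)` is an invariant ideal of `A`. The expectation of the quotient system is
faithful, which forces `I` into the kernel of `C_r^*(Σ) → C_r^*(Σ/J)`, that is, into `⟨J⟩` by
exactness. If `J` were all of `A`, then `E(y) = 1` for some self-adjoint `y ∈ I`; since (DP)
averages `1 - y` to `0` within the closed convex set `1 + I`, this gives `1 ∈ I`. Hence every proper
`I` lies in `⟨J⟩` for a proper invariant `J`. As `A ∩ ⟨J⟩ = J`, the map `J ↦ ⟨J⟩` is an order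
embedding of the proper invariant ideals with cofinal range in the proper ideals, and maximal
elements correspond. -/

theorem bijOn_maximal_of_cofinal {α β : Type*} [PartialOrder α] [PartialOrder β] {f : α → β}
    {p : α → Prop} {q : β → Prop} (hpq : ∀ a, p a → q (f a))
    (hle : ∀ a b, p a → p b → (f a ≤ f b ↔ a ≤ b)) (hcof : ∀ b, q b → ∃ a, p a ∧ b ≤ f a) :
    Set.BijOn f {a | Maximal p a} {b | Maximal q b} := by
  refine ⟨fun a ha => ⟨hpq a ha.prop, fun b hb hab => ?_⟩, fun a ha b hb hab => ?_, fun b hb => ?_⟩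
  · obtain ⟨c, hc, hbc⟩ := hcof b hb
    have hac : a ≤ c := (hle a c ha.prop hc).1 (hab.trans hbc)
    exact hbc.trans ((hle c a hc ha.prop).2 (ha.le_of_ge hc hac))
  · exact le_antisymm ((hle a b ha.prop hb.prop).1 hab.le) ((hle b a hb.prop ha.prop).1 hab.ge)
  · obtain ⟨a, ha, hba⟩ := hcof b hb.prop
    obtain rfl : b = f a := hb.eq_of_le (hpq a ha) hba
    refine ⟨a, ⟨ha, fun c hc hac => ?_⟩, rfl⟩
    exact (hle c a hc ha).1 (hb.le_of_ge (hpq c hc) ((hle a c ha hc).2 hac))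

namespace ClosedIdeal

open scoped CStarAlgebra

variable {A B : Type*} [CStarAlgebra A] [CStarAlgebra B]

theorem subset_generated (s : Set A) : s ⊆ (generated s : Set A) := fun _ hx =>
  Submodule.mem_sInf.2 fun _ hI => hI.2.2 hx

theorem generated_le {s : Set A} {J : ClosedIdeal A} (h : s ⊆ J) : generated s ≤ J := fun _ hx =>
  Submodule.mem_sInf.1 hx J.toIdeal ⟨J.isTwoSided, J.isClosed, h⟩

theorem coe_ne_univ_iff {J : ClosedIdeal A} : (J : Set A) ≠ Set.univ ↔ (1 : A) ∉ J := by
  rw [ne_eq, not_iff_not, Set.eq_univ_iff_forall]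
  exact ⟨fun h => h 1, fun h x => mul_one x ▸ J.mul_mem_left x h⟩

theorem coe_eq_singleton_zero_iff {J : ClosedIdeal A} : (J : Set A) = {0} ↔ ∀ a ∈ J, a = 0 :=
  ⟨fun h _ ha => h.subset ha, fun h => Set.Subset.antisymm h <|
    Set.singleton_subset_iff.2 J.toIdeal.zero_mem⟩

theorem realPart_mem (J : ClosedIdeal A) {x : A} (hx : x ∈ J) : (realPart x : A) ∈ J := by
  rw [realPart_apply_coe, Algebra.smul_def]
  exact J.mul_mem_left _ (J.toIdeal.add_mem hx (J.star_mem hx))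

theorem image_conjStarAlgAut (J : ClosedIdeal A) (v : unitary A) :
    Unitary.conjStarAlgAut ℂ A v '' (J : Set A) = J := by
  have hsub (w : unitary A) : Unitary.conjStarAlgAut ℂ A w '' (J : Set A) ⊆ J := by
    rintro _ ⟨x, hx, rfl⟩
    exact J.mul_mem_right _ (J.mul_mem_left _ hx)
  refine (hsub v).antisymm fun x hx => ⟨_, hsub (star v) ⟨x, hx, rfl⟩, ?_⟩
  rw [← Unitary.conjStarAlgAut_symm, StarAlgEquiv.apply_symm_apply]

theorem convex (J : ClosedIdeal A) : Convex ℝ (J : Set A) :=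
  (J.toIdeal.restrictScalars ℝ).convex

theorem sub_mem_of_mem_closure_convexHull (J : ClosedIdeal A) {c y z : A} (hc : c ∈ Set.center A)
    (hy : y - c ∈ J)
    (hz : z ∈ closure (convexHull ℝ {w | ∃ v ∈ unitary A, w = v * y * star v})) : z - c ∈ J := by
  have hconj : {w | ∃ v ∈ unitary A, w = v * y * star v} ⊆ (· - c) ⁻¹' (J : Set A) := by
    rintro _ ⟨v, hv, rfl⟩
    have hcv : v * c * star v = c := by
      rw [← (hc.comm v).eq, mul_assoc, Unitary.mul_star_self_of_mem hv, mul_one]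
    have h : v * y * star v - c = v * (y - c) * star v := by rw [mul_sub, sub_mul, hcv]
    exact Set.mem_preimage.2 (h ▸ J.mul_mem_right _ (J.mul_mem_left _ hy))
  have hconvex : Convex ℝ ((· - c) ⁻¹' (J : Set A)) := by
    simpa only [sub_eq_add_neg] using J.convex.translate_preimage_left (-c)
  exact closure_minimal (convexHull_min hconj hconvex) (J.isClosed.preimage (by fun_prop)) hz

/-- The preimage of a closed ideal under a ⋆-homomorphism, as a closed ideal. -/
def comap (φ : A →⋆ₐ[ℂ] B) (K : ClosedIdeal B) : ClosedIdeal A where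
  toIdeal := K.toIdeal.comap φ
  isTwoSided :=
    haveI := K.isTwoSided
    inferInstance
  isClosed := K.isClosed.preimage (map_continuous φ)

theorem mem_comap {φ : A →⋆ₐ[ℂ] B} {K : ClosedIdeal B} {a : A} : a ∈ K.comap φ ↔ φ a ∈ K := Iff.rfl

/-- The kernel of a ⋆-homomorphism, as a closed ideal. -/
def ker (φ : A →⋆ₐ[ℂ] B) : ClosedIdeal A where
  toIdeal := RingHom.ker φ
  isTwoSided := inferInstance
  isClosed := isClosed_singleton.preimage (map_continuous φ)

theorem mem_ker {φ : A →⋆ₐ[ℂ] B} {a : A} : a ∈ ker φ ↔ φ a = 0 := Iff.rfl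

theorem ker_quotMap (J : ClosedIdeal A) : ker J.quotMap = J :=
  SetLike.ext fun _ => J.quotMap_eq_zero_iff

theorem ker_le_comap (φ : A →⋆ₐ[ℂ] B) (K : ClosedIdeal B) : ker φ ≤ K.comap φ :=
  fun a (ha : φ a = 0) => mem_comap.2 (ha ▸ K.toIdeal.zero_mem)

theorem lift_ker_injective (φ : A →⋆ₐ[ℂ] B) :
    Function.Injective ((ker φ).lift φ fun _ ha => ha) := by
  rw [injective_iff_map_eq_zero]
  intro x hx
  obtain ⟨a, rfl⟩ := (ker φ).quotMap_surjective x
  exact (ker φ).quotMap_eq_zero_iff.2 hx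

theorem isClosed_range (φ : A →⋆ₐ[ℂ] B) : IsClosed (Set.range φ) := by
  have hrange : Set.range φ = Set.range ((ker φ).lift φ fun _ ha => ha) :=
    (ker φ).quotMap_surjective.range_comp ((ker φ).lift φ fun _ ha => ha)
  rw [hrange]
  exact (NonUnitalStarAlgHom.isometry _ (lift_ker_injective φ)).isClosedEmbedding.isClosed_range

theorem exists_quot_ker_equiv {φ : A →⋆ₐ[ℂ] B} (hφ : Function.Surjective φ) :
    ∃ e : (ker φ).Quot ≃⋆ₐ[ℂ] B, ∀ x, e ((ker φ).quotMap x) = φ x :=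
  ⟨StarAlgEquiv.ofBijective ((ker φ).lift φ fun _ ha => ha) ⟨lift_ker_injective φ,
    Function.Surjective.of_comp (g := (ker φ).quotMap) hφ⟩, fun _ => rfl⟩

theorem exists_comap_eq {φ : A →⋆ₐ[ℂ] B} (hφ : Function.Surjective φ) {K : ClosedIdeal A}
    (hK : ker φ ≤ K) :
    ∃ L : ClosedIdeal B, L.comap φ = K := by
  have hcomap : (K.toIdeal.map φ).comap φ = K.toIdeal :=
    (Ideal.comap_map_of_surjective φ hφ K.toIdeal).trans (sup_eq_left.2 hK)
  have htwoSided : (K.toIdeal.map φ).IsTwoSided :=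
    haveI := K.isTwoSided
    haveI : RingHomSurjective (φ : A →+* B) := ⟨hφ⟩
    inferInstanceAs (K.toIdeal.map (φ : A →+* B)).IsTwoSided
  have hclosed : IsClosed (K.toIdeal.map φ : Set B) := by
    let φL : A →L[ℂ] B := ⟨φ.toAlgHom.toLinearMap, map_continuous φ⟩
    exact (φL.isQuotientMap hφ).isClosed_preimage.1 (hcomap ▸ K.isClosed :)
  exact ⟨⟨K.toIdeal.map φ, htwoSided, hclosed⟩, SetLike.ext fun a => SetLike.ext_iff.1 hcomap a⟩

theorem isSimple_iff_isMaximal_ker {φ : A →⋆ₐ[ℂ] B} (hφ : Function.Surjective φ) :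
    IsSimpleCStarAlgebra B ↔ (ker φ).IsMaximal := by
  have hnontriv : Nontrivial B ↔ (ker φ : Set A) ≠ Set.univ := by
    rw [coe_ne_univ_iff, mem_ker, map_one]
    exact ⟨fun _ => one_ne_zero, fun h => ⟨1, 0, h⟩⟩
  have hzero (L : ClosedIdeal B) : (L : Set B) = {0} ↔ L.comap φ ≤ ker φ := by
    rw [coe_eq_singleton_zero_iff, hφ.forall]
    rfl
  have huniv (L : ClosedIdeal B) : (L : Set B) = Set.univ ↔ (L.comap φ : Set A) = Set.univ := by
    rw [← not_iff_not, ← ne_eq, ← ne_eq, coe_ne_univ_iff, coe_ne_univ_iff, mem_comap, map_one]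
  refine and_congr hnontriv ⟨fun h K hK hker => ?_, fun h L => ?_⟩
  · obtain ⟨L, rfl⟩ := exists_comap_eq hφ hker
    exact (hzero L).1 ((h L).resolve_right fun hL => hK ((huniv L).1 hL))
  · rw [or_iff_not_imp_right]
    exact fun hL => (hzero L).2 (h (mt (huniv L).2 hL) (ker_le_comap φ L))

end ClosedIdeal

namespace TwistedSystem

open scoped CStarAlgebra InnerProductSpace

variable {A : Type u} {G : Type v} [CStarAlgebra A] [Group G] (S : TwistedSystem A G)

theorem incl_injective : Function.Injective S.incl := Subtype.val_injective

theorem isClosedEmbedding_incl : Topology.IsClosedEmbedding S.incl :=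
  (NonUnitalStarAlgHom.isometry S.incl S.incl_injective).isClosedEmbedding

theorem incl_mem_closure_span (x : S.ReducedCrossedProduct) :
    S.incl x ∈ closure (Submodule.span ℂ (Set.range fun p : A × G => S.regA p.1 * S.regG p.2) :
      Set (HilbertSpace A G →L[ℂ] HilbertSpace A G)) :=
  closure_mono (fun _ hy => S.mem_span_of_mem_adjoin hy)
    (Subtype.property (p := fun y => y ∈ S.reducedAlgebra) x)

variable {S} in
theorem ReducedCrossedProduct.induction {p : S.ReducedCrossedProduct → Prop}
    (closed : IsClosed {x | p x}) (add : ∀ x y, p x → p y → p (x + y))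
    (gen : ∀ a g, p (S.ι a * S.lam g)) (x : S.ReducedCrossedProduct) : p x := by
  have hspan : (Submodule.span ℂ (Set.range fun p : A × G => S.regA p.1 * S.regG p.2) :
      Set (HilbertSpace A G →L[ℂ] HilbertSpace A G)) ⊆ S.incl '' {x | p x} := fun y hy => by
    induction hy using Submodule.closure_induction with
    | zero => exact ⟨0, by simpa using gen 0 1, map_zero _⟩
    | add y z _ _ hy hz =>
      obtain ⟨y, hy, rfl⟩ := hy
      obtain ⟨z, hz, rfl⟩ := hz
      exact ⟨y + z, add y z hy hz, map_add _ _ _⟩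
    | smul_mem c y hy =>
      obtain ⟨⟨a, g⟩, rfl⟩ := hy
      refine ⟨S.ι (c • a) * S.lam g, gen _ _, ?_⟩
      rw [map_smul, smul_mul_assoc, map_smul, map_mul]
      rfl
  have himage : S.incl x ∈ S.incl '' {x | p x} :=
    closure_minimal hspan (S.isClosedEmbedding_incl.isClosedMap _ closed)
      (S.incl_mem_closure_span x)
  exact S.incl_injective.mem_set_image.1 himage

@[fun_prop]
theorem continuous_E : Continuous S.E := by
  rw [(NonUnitalStarAlgHom.isometry (univRep A) (univRep_injective A)).isEmbedding.continuous_iff,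
    show univRep A ∘ S.E = compression ∘ S.incl from funext S.univRep_E]
  exact continuous_compression.comp S.isClosedEmbedding_incl.continuous

theorem lam_one : (S.lam 1 : S.ReducedCrossedProduct) = 1 := Subtype.ext S.regG_one

theorem star_lam (g : G) : star (S.lam g : S.ReducedCrossedProduct) =
    S.ι (star (S.σ g⁻¹ g : A)) * S.lam g⁻¹ := Subtype.ext (S.star_regG g)

theorem conj_lam (g h : G) : Unitary.conjStarAlgAut ℂ _ (S.lam g) (S.lam h) =
    S.ι (S.σ g h * star (S.σ (g * h * g⁻¹) g : A)) * S.lam (g * h * g⁻¹) := by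
  have hgh : (S.lam (g * h) : S.ReducedCrossedProduct) =
      S.ι (star (S.σ (g * h * g⁻¹) g : A)) * S.lam (g * h * g⁻¹) * S.lam g := by
    rw [mul_assoc, lam_mul_lam, ← mul_assoc, ← map_mul, Unitary.coe_star_mul_self, map_one,
      one_mul, inv_mul_cancel_right]
  rw [Unitary.conjStarAlgAut_apply, lam_mul_lam, hgh, map_mul]
  simp only [mul_assoc, Unitary.mul_star_self_of_mem (S.lam g).2, mul_one]

theorem conj_ι (g : G) (a : A) :
    Unitary.conjStarAlgAut ℂ _ (S.lam g) (S.ι a) = S.ι (S.α g a) := by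
  rw [Unitary.conjStarAlgAut_apply, lam_mul_ι, mul_assoc,
    Unitary.mul_star_self_of_mem (S.lam g).2, mul_one]

theorem E_one : S.E 1 = 1 := by rw [← map_one S.ι, E_ι]

theorem E_ι_mul (b : A) (x : S.ReducedCrossedProduct) : S.E (S.ι b * x) = b * S.E x := by
  induction x using ReducedCrossedProduct.induction with
  | closed => exact isClosed_eq (by fun_prop) (by fun_prop)
  | add x y hx hy => rw [mul_add, map_add, hx, hy, map_add, mul_add]
  | gen a g =>
    rw [← mul_assoc, ← map_mul]
    rcases eq_or_ne g 1 with rfl | hg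
    · simp only [lam_one, mul_one, E_ι]
    · rw [E_ι_mul_lam _ _ hg, E_ι_mul_lam _ _ hg, mul_zero]

theorem E_star (x : S.ReducedCrossedProduct) : S.E (star x) = star (S.E x) := by
  induction x using ReducedCrossedProduct.induction with
  | closed => exact isClosed_eq (by fun_prop) (by fun_prop)
  | add x y hx hy => rw [star_add, map_add, hx, hy, map_add, star_add]
  | gen a g =>
    rcases eq_or_ne g 1 with rfl | hg
    · simp only [lam_one, mul_one, ← map_star, E_ι]
    · rw [star_mul, star_lam, ← map_star, mul_assoc, lam_mul_ι, E_ι_mul,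
        E_ι_mul_lam _ _ (inv_ne_one.2 hg), E_ι_mul_lam _ _ hg, mul_zero, star_zero]

theorem E_mul_ι (x : S.ReducedCrossedProduct) (b : A) : S.E (x * S.ι b) = S.E x * b :=
  star_injective <| by rw [← E_star, star_mul, ← map_star, E_ι_mul, E_star, star_mul]

theorem E_realPart (x : S.ReducedCrossedProduct) : S.E (realPart x) = realPart (S.E x) := by
  simp only [realPart_apply_coe, LinearMap.map_smul_of_tower, map_add, E_star]

theorem E_conj (g : G) (x : S.ReducedCrossedProduct) :
    S.E (Unitary.conjStarAlgAut ℂ _ (S.lam g) x) = S.α g (S.E x) := by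
  induction x using ReducedCrossedProduct.induction with
  | closed =>
    have hα : Continuous (S.α g) := (StarAlgEquiv.isometry (S.α g)).continuous
    have hconj : Continuous (Unitary.conjStarAlgAut ℂ _ (S.lam g)) :=
      (StarAlgEquiv.isometry _).continuous
    exact isClosed_eq (by fun_prop) (by fun_prop)
  | add x y hx hy => rw [map_add, map_add, hx, hy, map_add, map_add]
  | gen a h =>
    rw [map_mul, conj_ι, conj_lam, E_ι_mul]
    rcases eq_or_ne h 1 with rfl | hh
    · simp only [S.σ_one_right, S.σ_one_left, OneMemClass.coe_one, mul_one, mul_inv_cancel,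
        star_one, map_one, lam_one, E_one, E_ι]
    · rw [E_ι_mul_lam _ _ (mt conj_eq_one_iff.1 hh), E_ι_mul_lam _ _ hh, mul_zero, map_zero]

theorem E_conj_symm (g : G) (x : S.ReducedCrossedProduct) :
    S.E ((Unitary.conjStarAlgAut ℂ _ (S.lam g)).symm x) = (S.α g).symm (S.E x) := by
  rw [StarAlgEquiv.eq_symm_apply, ← E_conj, StarAlgEquiv.apply_symm_apply]

open Classical in
theorem regG_single (g : G) (v : UnivSpace A) :
    S.regG g (lp.single 2 1 v) = lp.single 2 g (univRep A (S.σ g⁻¹ g : A) v) := by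
  ext h
  rw [regG_apply]
  obtain rfl | hh := eq_or_ne h g
  · rw [inv_mul_cancel, lp.single_apply_self, lp.single_apply_self]
  · rw [lp.single_apply_ne _ _ _ hh, lp.single_apply_ne _ _ _ (mt inv_mul_eq_one.1 hh.symm),
      map_zero]

open Classical in
theorem single_eq_regG (g : G) (v : UnivSpace A) : (lp.single 2 g v : HilbertSpace A G) =
    S.regG g (lp.single 2 1 (univRep A (star (S.σ g⁻¹ g : A)) v)) := by
  rw [regG_single, ← mul_apply_eq_comp, ← map_mul, Unitary.mul_star_self_of_mem (S.σ g⁻¹ g).2,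
    map_one, one_apply_eq_self]

open Classical in
theorem inner_univRep_E_star_mul (x y : S.ReducedCrossedProduct) (v w : UnivSpace A) :
    ⟪v, univRep A (S.E (star x * y)) w⟫_ℂ =
      ⟪S.incl x (lp.single 2 1 v), S.incl y (lp.single 2 1 w)⟫_ℂ := by
  rw [← ContinuousLinearMap.adjoint_inner_right, ← ContinuousLinearMap.star_eq_adjoint, ← map_star,
    ← mul_apply_eq_comp, ← map_mul, lp.inner_single_left, univRep_E]
  rfl

open Classical in
theorem incl_apply_single_one_eq_zero {x : S.ReducedCrossedProduct} (hx : S.E (star x * x) = 0)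
    (v : UnivSpace A) : S.incl x (lp.single 2 1 v) = 0 := by
  rw [← inner_self_eq_zero (𝕜 := ℂ), ← inner_univRep_E_star_mul, hx, map_zero, zero_apply]
  exact inner_zero_right v

theorem eq_zero_of_E_star_mul_self {x : S.ReducedCrossedProduct} (hx : S.E (star x * x) = 0) :
    x = 0 := by
  classical
  have hxg (g : G) : S.E (star (x * S.lam g) * (x * S.lam g)) = 0 := by
    have hconj : star (x * S.lam g) * (x * S.lam g) =
        (Unitary.conjStarAlgAut ℂ _ (S.lam g)).symm (star x * x) := by
      simp only [Unitary.conjStarAlgAut_symm_apply, star_mul, mul_assoc]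
    rw [hconj, E_conj_symm, hx, map_zero]
  refine S.incl_injective (lp.ext_continuousLinearMap ENNReal.ofNat_ne_top fun g => ?_)
  ext1 v
  change S.incl x (lp.single 2 g v) = S.incl 0 (lp.single 2 g v)
  rw [S.single_eq_regG, map_zero, zero_apply]
  exact S.incl_apply_single_one_eq_zero (hxg g) _

section Functoriality

variable {B : Type u} [CStarAlgebra B] {S : TwistedSystem A G} {S' : TwistedSystem B G}
  {q : A →⋆ₐ[ℂ] B} (hq : IsEquivariantSurjection S S' q)

theorem E_map (x : S.ReducedCrossedProduct) : S'.E (map hq x) = q (S.E x) := by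
  induction x using ReducedCrossedProduct.induction with
  | closed =>
    have hmap : Continuous (map hq) := map_continuous (map hq)
    have hcont : Continuous q := map_continuous q
    exact isClosed_eq (by fun_prop) (by fun_prop)
  | add x y hx hy => rw [map_add, map_add, hx, hy, map_add, map_add]
  | gen a g =>
    rw [map_mul, map_ι, map_lam]
    rcases eq_or_ne g 1 with rfl | hg
    · simp only [lam_one, mul_one, E_ι]
    · rw [E_ι_mul_lam _ _ hg, E_ι_mul_lam _ _ hg, map_zero]

theorem map_surjective : Function.Surjective (map hq) := fun x => by
  induction x using ReducedCrossedProduct.induction with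
  | closed => exact ClosedIdeal.isClosed_range (map hq)
  | add x y hx hy =>
    obtain ⟨x, rfl⟩ := hx
    obtain ⟨y, rfl⟩ := hy
    exact ⟨x + y, map_add _ _ _⟩
  | gen b g =>
    obtain ⟨a, rfl⟩ := hq.surjective b
    exact ⟨S.ι a * S.lam g, by rw [map_mul, map_ι, map_lam]⟩

end Functoriality

theorem ι_mem_induced {J : ClosedIdeal A} {a : A} (ha : a ∈ J) : S.ι a ∈ S.induced J :=
  ClosedIdeal.subset_generated _ ⟨a, ha, rfl⟩

theorem induced_le_iff {J : ClosedIdeal A} {I : ClosedIdeal S.ReducedCrossedProduct} :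
    S.induced J ≤ I ↔ J ≤ I.comap S.ι :=
  ⟨fun h _ ha => h (S.ι_mem_induced ha),
    fun h => ClosedIdeal.generated_le (Set.image_subset_iff.2 h)⟩

theorem induced_le_ker_quotientHom {J : ClosedIdeal A} (hJ : S.IsInvariant J) :
    S.induced J ≤ ClosedIdeal.ker (S.quotientHom J hJ) :=
  S.induced_le_iff.2 fun a (ha : a ∈ J) => by
    change map _ (S.ι a) = 0
    rw [map_ι, J.quotMap_eq_zero_iff.2 ha, map_zero]

theorem E_mem_of_mem_ker_quotientHom {J : ClosedIdeal A} (hJ : S.IsInvariant J)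
    {x : S.ReducedCrossedProduct} (hx : S.quotientHom J hJ x = 0) : S.E x ∈ J := by
  rw [← J.quotMap_eq_zero_iff, ← E_map (S.isEquivariantSurjection_quotMap J hJ)]
  exact (congrArg _ hx).trans (map_zero _)

theorem comap_ι_induced {J : ClosedIdeal A} (hJ : S.IsInvariant J) :
    (S.induced J).comap S.ι = J := by
  refine le_antisymm (fun a (ha : S.ι a ∈ S.induced J) => show a ∈ J from ?_)
    (S.induced_le_iff.1 le_rfl)
  rw [← S.E_ι a]
  exact S.E_mem_of_mem_ker_quotientHom hJ (S.induced_le_ker_quotientHom hJ ha)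

theorem induced_le_induced_iff {J K : ClosedIdeal A} (hK : S.IsInvariant K) :
    S.induced J ≤ S.induced K ↔ J ≤ K := by
  rw [induced_le_iff, S.comap_ι_induced hK]

theorem coe_induced_ne_univ_iff {J : ClosedIdeal A} (hJ : S.IsInvariant J) :
    (S.induced J : Set S.ReducedCrossedProduct) ≠ Set.univ ↔ (J : Set A) ≠ Set.univ := by
  conv_rhs => rw [← S.comap_ι_induced hJ]
  rw [ClosedIdeal.coe_ne_univ_iff, ClosedIdeal.coe_ne_univ_iff, ClosedIdeal.mem_comap, map_one]

/-- The image `E(I)` of an ideal of the crossed product under the conditional expectation, which is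
a two-sided ideal of `A` but need not be closed. -/
noncomputable def expectationIdeal (I : ClosedIdeal S.ReducedCrossedProduct) : Ideal A where
  carrier := S.E '' I
  add_mem' := by
    rintro _ _ ⟨x, hx, rfl⟩ ⟨y, hy, rfl⟩
    exact ⟨x + y, I.toIdeal.add_mem hx hy, map_add _ _ _⟩
  zero_mem' := ⟨0, I.toIdeal.zero_mem, map_zero _⟩
  smul_mem' := by
    rintro a _ ⟨x, hx, rfl⟩
    exact ⟨S.ι a * x, I.mul_mem_left _ hx, S.E_ι_mul a x⟩

/-- The closure of `E(I)`, a closed two-sided ideal of `A`. -/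
noncomputable def expectationClosure (I : ClosedIdeal S.ReducedCrossedProduct) : ClosedIdeal A where
  toIdeal := (S.expectationIdeal I).closure
  isTwoSided := ⟨fun {a} b ha => by
    refine map_mem_closure (f := fun x => x * b) (by fun_prop) ha ?_
    rintro _ ⟨x, hx, rfl⟩
    exact ⟨x * S.ι b, I.mul_mem_right _ hx, S.E_mul_ι x b⟩⟩
  isClosed := isClosed_closure

theorem coe_expectationClosure (I : ClosedIdeal S.ReducedCrossedProduct) :
    (S.expectationClosure I : Set A) = closure (S.E '' I) := rfl

theorem E_mem_expectationClosure {I : ClosedIdeal S.ReducedCrossedProduct}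
    {x : S.ReducedCrossedProduct} (hx : x ∈ I) : S.E x ∈ S.expectationClosure I :=
  subset_closure ⟨x, hx, rfl⟩

theorem isInvariant_expectationClosure (I : ClosedIdeal S.ReducedCrossedProduct) :
    S.IsInvariant (S.expectationClosure I) := fun g => by
  have himage : S.α g '' (S.E '' I) = S.E '' I := by
    conv_rhs => rw [← I.image_conjStarAlgAut (S.lam g)]
    simp only [Set.image_image, E_conj]
  rw [coe_expectationClosure, ← (StarAlgEquiv.isometry (S.α g)).isClosedEmbedding.closure_image_eq,
    himage]

variable {S}

theorem HasDP.one_mem_of_E_eq_one (hDP : S.HasDP) {I : ClosedIdeal S.ReducedCrossedProduct}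
    {x : S.ReducedCrossedProduct} (hx : x ∈ I) (hE : S.E x = 1) : 1 ∈ I := by
  let y : S.ReducedCrossedProduct := realPart x
  have hEy : S.E y = 1 := by
    rw [E_realPart, hE, (IsSelfAdjoint.one A).coe_realPart]
  have hzero := hDP (1 - y) (by rw [star_sub, star_one, selfAdjoint.star_val_eq])
    (by rw [map_sub, E_one, hEy, sub_self])
  have hmem : 1 - y - 1 ∈ I := by
    rw [sub_sub_cancel_left]
    exact I.toIdeal.neg_mem (I.realPart_mem hx)
  have hneg : 0 - 1 ∈ I := I.sub_mem_of_mem_closure_convexHull Set.one_mem_center hmem hzero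
  rwa [zero_sub, ← ClosedIdeal.mem_toIdeal, neg_mem_iff] at hneg

theorem HasDP.coe_expectationClosure_ne_univ (hDP : S.HasDP)
    {I : ClosedIdeal S.ReducedCrossedProduct} (hI : (I : Set S.ReducedCrossedProduct) ≠ Set.univ) :
    (S.expectationClosure I : Set A) ≠ Set.univ := by
  have hproper : S.expectationIdeal I ≠ ⊤ := (Ideal.ne_top_iff_one _).2 fun ⟨_, hx, hE⟩ =>
    ClosedIdeal.coe_ne_univ_iff.1 hI (hDP.one_mem_of_E_eq_one hx hE)
  exact fun h => Ideal.closure_ne_top _ hproper (SetLike.coe_injective h)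

theorem IsExact.ker_quotientHom (hexact : S.IsExact) {J : ClosedIdeal A} (hJ : S.IsInvariant J) :
    ClosedIdeal.ker (S.quotientHom J hJ) = S.induced J :=
  SetLike.coe_injective (hexact J hJ).symm

theorem le_ker_quotientHom_expectationClosure (I : ClosedIdeal S.ReducedCrossedProduct) :
    I ≤ ClosedIdeal.ker (S.quotientHom _ (S.isInvariant_expectationClosure I)) := by
  intro x hx
  refine ClosedIdeal.mem_ker.2 (eq_zero_of_E_star_mul_self _ ?_)
  rw [← map_star, ← map_mul]
  exact (E_map _ _).trans ((ClosedIdeal.quotMap_eq_zero_iff _).2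
    (S.E_mem_expectationClosure (I.mul_mem_left _ hx)))

theorem IsExact.le_induced_expectationClosure (hexact : S.IsExact)
    (I : ClosedIdeal S.ReducedCrossedProduct) : I ≤ S.induced (S.expectationClosure I) :=
  (le_ker_quotientHom_expectationClosure I).trans_eq (hexact.ker_quotientHom _)

theorem bijOn_induced (hexact : S.IsExact) (hDP : S.HasDP) :
    Set.BijOn S.induced {J : ClosedIdeal A | S.IsMaximalInvariant J}
      {I : ClosedIdeal S.ReducedCrossedProduct | I.IsMaximal} :=
  bijOn_maximal_of_cofinal (fun _ hJ => (S.coe_induced_ne_univ_iff hJ.1).2 hJ.2)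
    (fun _ _ _ hK => S.induced_le_induced_iff hK.1)
    fun I hI => ⟨S.expectationClosure I, ⟨S.isInvariant_expectationClosure I,
      hDP.coe_expectationClosure_ne_univ hI⟩, hexact.le_induced_expectationClosure I⟩

theorem IsExact.exists_quot_induced_equiv (hexact : S.IsExact) {J : ClosedIdeal A}
    (hJ : S.IsInvariant J) :
    ∃ e : (S.induced J).Quot ≃⋆ₐ[ℂ] (S.quotient J hJ).ReducedCrossedProduct,
      ∀ x, e ((S.induced J).quotMap x) = S.quotientHom J hJ x :=
  hexact.ker_quotientHom hJ ▸ ClosedIdeal.exists_quot_ker_equiv (map_surjective _)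

end TwistedSystem

theorem theorem3p7 {A : Type*} {G : Type*} [CStarAlgebra A] [Group G] (S : TwistedSystem A G)
    (hexact : S.IsExact) (hDP : S.HasDP) :
    Set.BijOn S.induced {J : ClosedIdeal A | S.IsMaximalInvariant J}
      {I : ClosedIdeal S.ReducedCrossedProduct | I.IsMaximal} ∧
    (∀ (J : ClosedIdeal A) (hJ : S.IsInvariant J), S.IsMaximalInvariant J →
      IsSimpleCStarAlgebra (S.quotient J hJ).ReducedCrossedProduct ∧
      ∃ e : (S.induced J).Quot ≃⋆ₐ[ℂ] (S.quotient J hJ).ReducedCrossedProduct,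
        ∀ x, e ((S.induced J).quotMap x) = S.quotientHom J hJ x) ∧
    (∀ I : ClosedIdeal S.ReducedCrossedProduct, IsSimpleCStarAlgebra I.Quot →
      ∃ (J : ClosedIdeal A) (hJ : S.IsInvariant J), S.IsMaximalInvariant J ∧ I = S.induced J ∧
        ∃ e : I.Quot ≃⋆ₐ[ℂ] (S.quotient J hJ).ReducedCrossedProduct,
          ∀ x, e (I.quotMap x) = S.quotientHom J hJ x) := by
  have hbij := TwistedSystem.bijOn_induced hexact hDP
  refine ⟨hbij, fun J hJ hmax => ⟨?_, hexact.exists_quot_induced_equiv hJ⟩, fun I hI => ?_⟩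
  · rw [ClosedIdeal.isSimple_iff_isMaximal_ker (TwistedSystem.map_surjective
      (S.isEquivariantSurjection_quotMap J hJ))]
    exact hexact.ker_quotientHom hJ ▸ hbij.mapsTo hmax
  · rw [ClosedIdeal.isSimple_iff_isMaximal_ker I.quotMap_surjective, I.ker_quotMap] at hI
    obtain ⟨J, hmax : S.IsMaximalInvariant J, rfl⟩ := hbij.surjOn hI
    have hJ : S.IsInvariant J := (Maximal.prop hmax).1
    exact ⟨J, hJ, hmax, rfl, hexact.exists_quot_induced_equiv hJ⟩
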